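/- Conventions. Let $\langle i,k\rangle$ be the standard computable pairing bijection $\omega^2\to\omega$. Fix the signature $\{0,-,+\}$ of additive groups, with equality. For a tree $T\subseteq\omega^{<\omega}$ let $[T]$ be its set of infinite paths. A \emph{computable tree presentation} of a group $S$ in this signature is a computable subtree $T\subseteq\omega^{<\omega}$, all of whose nodes are extendible to paths, together with Turing functionals which, given as oracle the join $X_1\oplus\cdots\oplus X_n$ of the arguments, compute operations $0,-,+$ on $[T]$ such that the resulting structure $\mathcal A_T$ with domain $[T]$ is isomorphic to $S$. The \emph{positive atomic diagram} of $\vec X\in[T]^n$ is the set of Gödel codes of the atomic formulas $\alpha(x_1,\dots,x_n)$ with $\mathcal A_T\models\alpha(\vec X)$; an \emph{enumeration} of a set $S\subseteq\omega$ is a set $D\subseteq\omega$ with $S=\{x:\exists y\ \langle x,y\rangle\in D\}$. The presentation is \emph{tree-decidable} if there is one Turing functional $\Phi$ such that, for every $n\geq 0$, every first-order formula $\alpha(x_1,\dots,x_n)$ of the signature, every $\vec X\in[T]^n$ and every enumeration $D$ of the positive atomic diagram of $\vec X$, the computation $\Phi^{X_1\oplus\cdots\oplus X_n\oplus D}(\ulcorner\alpha(x_1,\dots,x_n)\urcorner)$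 halts, with output $1$ if $\mathcal A_T\models\alpha(\vec X)$ and output $0$ otherwise. For a prime $p$, let $T_p^+$ be the tree of all strings $(k_1,\dots,k_n)$ with $0\leq k_i<p^i$ for all $i\leq n$ and $k_{i+1}\equiv k_i \bmod p^i$ for all $i<n$, with the operations $0=(0,0,\dots)$, $-(k_i)_i=(-k_i\bmod p^i)_i$ and $(j_i)_i+(k_i)_i=(j_i+k_i\bmod p^i)_i$ on its paths. Let $T$ be the infinite Cartesian product of the presentations $T_{p_0}^+,T_{p_1}^+,\dots$, where $p_0<p_1<\cdots$ are all the primes: level $\langle i,l\rangle$ of $T$ replicates level $l$ of $T_{p_i}^+$, and the operations act on each coordinate separately. Theorem. $T$ is a computable tree presentation of the group $\widehat{\mathbb Z}$, the profinite completion of $\mathbb Z$, and it is tree-decidable. Moreover, consider the existential-atomic formulas $$\exists G\ \ t(F_1,\dots,F_n,G)=s(F_1,\dots,F_n,G)$$ ($n\ge 0$, with $t,s$ terms) whose equation involves $G$ properly, i.e. reads $\sum_i a_iF_i=bG$ over abelian groups, with integers $a_i$ and $b\neq 0$. Then: (1) these formulas define effectively clopen subsets of $[T]^n$, uniformly in the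 formula: from the formula one can uniformly enumerate a collection of basic open sets $\{\vec X\in[T]^n:\sigma_j\sqsubset X_j \text{ for all } j\}$ whose union is the defined set, and likewise such a collection whose union is its complement; (2) whenever such a formula holds of $\vec F\in[T]^n$, it has exactly one witness $G\in[T]$, and one Turing functional computes $G$ from the oracle $F_1\oplus\cdots\oplus F_n$ uniformly in the formula. -/

import Mathlib

open FirstOrder

/-! ### Turing functionals -/

/-- Turing functionals `A ↦ Φ^A`, where the oracle `A` is a total function `ℕ → ℕ`: the partial
recursive functionals, obtained *uniformly in the oracle* from the basic functions and the oracle by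
pairing, composition, primitive recursion and unbounded search (the clauses are those of
`Nat.Partrec` together with a clause for queries to the oracle). -/
inductive IsTuringFunctional : ((ℕ → ℕ) → ℕ →. ℕ) → Prop
  | zero : IsTuringFunctional fun _ _ => Part.some 0
  | succ : IsTuringFunctional fun _ n => Part.some (n + 1)
  | left : IsTuringFunctional fun _ n => Part.some n.unpair.1
  | right : IsTuringFunctional fun _ n => Part.some n.unpair.2
  | oracle : IsTuringFunctional fun A n => Part.some (A n)
  | pair {Φ Ψ : (ℕ → ℕ) → ℕ →. ℕ} : IsTuringFunctional Φ → IsTuringFunctional Ψ →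
      IsTuringFunctional fun A n => Nat.pair <$> Φ A n <*> Ψ A n
  | comp {Φ Ψ : (ℕ → ℕ) → ℕ →. ℕ} : IsTuringFunctional Φ → IsTuringFunctional Ψ →
      IsTuringFunctional fun A n => Ψ A n >>= Φ A
  | prec {Φ Ψ : (ℕ → ℕ) → ℕ →. ℕ} : IsTuringFunctional Φ → IsTuringFunctional Ψ →
      IsTuringFunctional fun A => Nat.unpaired fun a n =>
        n.rec (Φ A a) fun y IH => do
          let i ← IH
          Ψ A (Nat.pair a (Nat.pair y i))
  | rfind {Φ : (ℕ → ℕ) → ℕ →. ℕ} : IsTuringFunctional Φ →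
      IsTuringFunctional fun A a =>
        Nat.rfind fun n => (fun m => decide (m = 0)) <$> Φ A (Nat.pair a n)

/-- The join `X₀ ⊕ ⋯ ⊕ Xₙ₋₁` of finitely many functions: its value at `⟨i, k⟩` is `Xᵢ(k)`. -/
def oracleJoin {n : ℕ} (X : Fin n → ℕ → ℕ) : ℕ → ℕ := fun m =>
  if h : m.unpair.1 < n then X ⟨m.unpair.1, h⟩ m.unpair.2 else 0

/-- The characteristic function of a set of natural numbers. -/
noncomputable def charFun (D : Set ℕ) : ℕ → ℕ := D.indicator 1

/-! ### The signature of additive groups, and Gödel numbers -/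

/-- The function symbols `0`, `-`, `+` of the signature of additive groups. -/
inductive AddGroupFunc : ℕ → Type
  | zero : AddGroupFunc 0
  | neg : AddGroupFunc 1
  | add : AddGroupFunc 2

/-- The signature of additive groups (with equality, and without further relation symbols). -/
def addGroupLang : FirstOrder.Language.{0, 0} where
  Functions := AddGroupFunc
  Relations := fun _ => Empty

/-- The structure given by a zero, a negation and an addition. -/
@[reducible]
def addGroupLang.mkStructure {M : Type*} (zero : M) (neg : M → M) (add : M → M → M) :
    addGroupLang.Structure M where
  funMap
    | AddGroupFunc.zero, _ => zero
    | AddGroupFunc.neg, x => neg (x 0)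
    | AddGroupFunc.add, x => add (x 0) (x 1)
  RelMap := fun r _ => r.elim

/-- The Gödel number of a term, given a numbering `v` of the variables. -/
def termCode {α : Type} (v : α → ℕ) : addGroupLang.Term α → ℕ
  | .var a => Nat.pair 0 (v a)
  | .func AddGroupFunc.zero _ => Nat.pair 1 0
  | .func AddGroupFunc.neg ts => Nat.pair 2 (termCode v (ts 0))
  | .func AddGroupFunc.add ts => Nat.pair 3 (Nat.pair (termCode v (ts 0)) (termCode v (ts 1)))

/-- The index of a free variable or of a bound variable: the free variables are `x₀, …, xₙ₋₁`, and
the `j`-th bound variable is `xₙ₊ⱼ`. -/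
def varIndex (n k : ℕ) : Fin n ⊕ Fin k → ℕ
  | .inl i => i
  | .inr j => n + j

/-- The Gödel number of a formula with free variables `x₀, …, xₙ₋₁`; the variable bound by the
`j`-th nested quantifier, counted from outside, is `xₙ₊ⱼ`. -/
def formulaCode {n : ℕ} : {k : ℕ} → addGroupLang.BoundedFormula (Fin n) k → ℕ
  | _, .falsum => Nat.pair 0 0
  | _, .equal t s => Nat.pair 1 (Nat.pair (termCode (varIndex n _) t) (termCode (varIndex n _) s))
  | _, .rel r _ => Empty.elim r
  | _, .imp φ ψ => Nat.pair 2 (Nat.pair (formulaCode φ) (formulaCode ψ))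
  | _, .all φ => Nat.pair 3 (formulaCode φ)

/-- The Gödel number `⌜φ(x₀, …, xₙ₋₁)⌝` of a formula together with its list of variables. -/
def godel {n : ℕ} (φ : addGroupLang.Formula (Fin n)) : ℕ := Nat.pair n (formulaCode φ)

/-! ### Trees and tree presentations -/

/-- The set `[T]` of infinite paths through a tree `T` of finite strings of natural numbers. -/
def Paths (T : Set (List ℕ)) : Type := {X : ℕ → ℕ // ∀ n, (List.range n).map X ∈ T}

/-- The string `σ` is an initial segment of the infinite sequence `X`. -/
def IsInitialSegment (σ : List ℕ) (X : ℕ → ℕ) : Prop := σ = (List.range σ.length).map X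

/-- A set of strings together with a structure, in the signature of additive groups, whose domain is
the set of its paths. -/
structure TreeStructure where
  tree : Set (List ℕ)
  str : addGroupLang.Structure (Paths tree)

attribute [instance] TreeStructure.str

namespace TreeStructure

/-- The domain `[T]` of the structure. -/
abbrev Dom (A : TreeStructure) : Type := Paths A.tree

/-- `A` is a computable tree presentation: its strings form a computable tree all of whose nodes are
extendible, and each of its (finitely many) operations is given by a Turing functional. -/
structure IsComputablePresentation (A : TreeStructure) : Prop where
  isTree : ∀ σ τ : List ℕ, σ <+: τ → τ ∈ A.tree → σ ∈ A.tree
  computable : ComputablePred fun σ : List ℕ => σ ∈ A.tree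
  extendible : ∀ σ ∈ A.tree, ∃ X : A.Dom, IsInitialSegment σ X.1
  functional : ∀ {n : ℕ} (f : addGroupLang.Functions n),
    ∃ Φ : (ℕ → ℕ) → ℕ →. ℕ, IsTuringFunctional Φ ∧
      ∀ (X : Fin n → A.Dom) (k : ℕ),
        Φ (oracleJoin fun i => (X i).1) k = Part.some ((FirstOrder.Language.Structure.funMap f X).1 k)

/-- The positive atomic diagram of a tuple: the set of the Gödel numbers of the atomic formulas that
hold of it. -/
def posAtomicDiagram (A : TreeStructure) {n : ℕ} (X : Fin n → A.Dom) : Set ℕ :=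
  {c | ∃ α : addGroupLang.Formula (Fin n), α.IsAtomic ∧ α.Realize X ∧ godel α = c}

/-- `D` is an enumeration of `S`: the set of the `x` with `⟨x, y⟩ ∈ D` for some `y` is `S`. -/
def _root_.IsEnumeration (D S : Set ℕ) : Prop := S = {x | ∃ y, Nat.pair x y ∈ D}

open Classical in
/-- `A` is tree-decidable: some Turing functional decides every formula of every tuple, given the
tuple and any enumeration `D` of its positive atomic diagram. The oracle is
`X₀ ⊕ ⋯ ⊕ Xₙ₋₁ ⊕ D`. -/
def IsTreeDecidable (A : TreeStructure) : Prop :=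
  ∃ Φ : (ℕ → ℕ) → ℕ →. ℕ, IsTuringFunctional Φ ∧
    ∀ (n : ℕ) (α : addGroupLang.Formula (Fin n)) (X : Fin n → A.Dom) (D : Set ℕ),
      IsEnumeration D (A.posAtomicDiagram X) →
        Φ (oracleJoin (Fin.snoc (α := fun _ => ℕ → ℕ) (fun i => (X i).1) (charFun D))) (godel α) =
          Part.some (if α.Realize X then 1 else 0)

/-- The sets `S n φ ⊆ [T]ⁿ`, for the formulas `φ` in the class `𝓕`, are effectively open uniformly
in `φ`: there is a c.e. set `W` such that `S n φ` is the union of the basic open sets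
`{X | σⱼ ⊂ Xⱼ for all j}` with `(⌜φ⌝, (σ₀, …, σₙ₋₁)) ∈ W`. -/
def UniformlyEffectivelyOpen (A : TreeStructure)
    (𝓕 : (n : ℕ) → Set (addGroupLang.Formula (Fin n)))
    (S : (n : ℕ) → addGroupLang.Formula (Fin n) → Set (Fin n → A.Dom)) : Prop :=
  ∃ W : ℕ × List (List ℕ) → Prop, REPred W ∧
    ∀ (n : ℕ), ∀ φ ∈ 𝓕 n, ∀ X : Fin n → A.Dom, X ∈ S n φ ↔
      ∃ σ : Fin n → List ℕ, W (godel φ, List.ofFn σ) ∧ ∀ j, IsInitialSegment (σ j) (X j).1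

/-- The formulas in `𝓕` define effectively clopen sets, uniformly in the formula: the defined sets
and their complements are uniformly effectively open. -/
def UniformlyEffectivelyClopen (A : TreeStructure)
    (𝓕 : (n : ℕ) → Set (addGroupLang.Formula (Fin n))) : Prop :=
  A.UniformlyEffectivelyOpen 𝓕 (fun _ φ => {X | φ.Realize X}) ∧
  A.UniformlyEffectivelyOpen 𝓕 (fun _ φ => {X | ¬ φ.Realize X})

end TreeStructure

/-! ### Existential-atomic formulas -/

/-- The coefficient of the variable `a` in a term, read as an integral linear combination of the
variables. -/
def termCoeff {α : Type} [DecidableEq α] (a : α) : addGroupLang.Term α → ℤ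
  | .var b => if b = a then 1 else 0
  | .func AddGroupFunc.zero _ => 0
  | .func AddGroupFunc.neg ts => - termCoeff a (ts 0)
  | .func AddGroupFunc.add ts => termCoeff a (ts 0) + termCoeff a (ts 1)

/-- The equation `t(F₀, …, Fₙ₋₁, G) = s(F₀, …, Fₙ₋₁, G)` involves `G` properly: over abelian
groups it reads `∑ aᵢ Fᵢ = b G` with `b ≠ 0`. Here `G` is the variable `Sum.inr 0`. -/
def ProperEquation {n : ℕ} (t s : addGroupLang.Term (Fin n ⊕ Fin 1)) : Prop :=
  termCoeff (Sum.inr 0) t ≠ termCoeff (Sum.inr 0) s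

/-- The existential-atomic formula `∃ G, t(F₀, …, Fₙ₋₁, G) = s(F₀, …, Fₙ₋₁, G)`. -/
def existsEq {n : ℕ} (t s : addGroupLang.Term (Fin n ⊕ Fin 1)) : addGroupLang.Formula (Fin n) :=
  (t.bdEqual s).ex

/-- The properly existential-atomic formulas. -/
def properExistentialAtomic (n : ℕ) : Set (addGroupLang.Formula (Fin n)) :=
  {φ | ∃ t s : addGroupLang.Term (Fin n ⊕ Fin 1), ProperEquation t s ∧ φ = existsEq t s}

/-- The paths `F₀, …, Fₙ₋₁, G` satisfy the equation `t = s`. -/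
def TreeStructure.SatisfiesEq (A : TreeStructure) {n : ℕ}
    (t s : addGroupLang.Term (Fin n ⊕ Fin 1)) (F : Fin n → A.Dom) (G : A.Dom) : Prop :=
  t.realize (Sum.elim F fun _ => G) = s.realize (Sum.elim F fun _ => G)

/-- Properly existential-atomic formulas have, whenever they hold, a unique witness, which a single
Turing functional computes uniformly from the formula and the parameters. -/
def TreeStructure.HasUniformlyComputableUniqueWitnesses (A : TreeStructure) : Prop :=
  ∃ Ψ : (ℕ → ℕ) → ℕ →. ℕ, IsTuringFunctional Ψ ∧
    ∀ (n : ℕ) (t s : addGroupLang.Term (Fin n ⊕ Fin 1)), ProperEquation t s →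
      ∀ F : Fin n → A.Dom, (existsEq t s).Realize F →
        ∃ G : A.Dom, A.SatisfiesEq t s F G ∧ (∀ G' : A.Dom, A.SatisfiesEq t s F G' → G' = G) ∧
          ∀ k : ℕ, Ψ (oracleJoin fun i => (F i).1) (Nat.pair (godel (existsEq t s)) k) =
            Part.some (G.1 k)

/-! ### Infinite Cartesian products of tree presentations -/

/-- The `i`-th column `(σ⟨i,0⟩, σ⟨i,1⟩, …)` of a string `σ`, as long as `σ` is defined. -/
def column (i : ℕ) (σ : List ℕ) : List ℕ :=
  ((List.range σ.length).filter fun l => Nat.pair i l < σ.length).map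
    fun l => σ.getD (Nat.pair i l) 0

/-- The product of a sequence of trees: level `⟨i, l⟩` of the product replicates level `l` of the
`i`-th tree. -/
def prodTree (T : ℕ → Set (List ℕ)) : Set (List ℕ) := {σ | ∀ i, column i σ ∈ T i}

theorem filter_range_lt (k n : ℕ) (h : k ≤ n) :
    (List.range n).filter (fun l => l < k) = List.range k := by
  induction n with
  | zero =>
    obtain rfl : k = 0 := by omega
    rfl
  | succ n ih =>
    rcases Nat.lt_or_ge n k with hk | hk
    · obtain rfl : k = n + 1 := by omega
      rw [List.filter_eq_self]
      intro a ha
      simpa using ha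
    · rw [List.range_succ, List.filter_append, ih hk]
      simp [hk]

theorem column_map_range (X : ℕ → ℕ) (i n k : ℕ) (hk : k ≤ n)
    (h : ∀ l, Nat.pair i l < n ↔ l < k) :
    column i ((List.range n).map X) = (List.range k).map fun l => X (Nat.pair i l) := by
  have h1 : ((List.range n).filter fun l => Nat.pair i l < n) = List.range k := by
    simp only [h]
    exact filter_range_lt k n hk
  simp only [column, List.length_map, List.length_range, h1]
  refine List.map_congr_left fun l hl => ?_
  have hl' : Nat.pair i l < n := (h l).2 (by simpa using hl)
  simp [List.getD, hl']

theorem column_map_range_pair (X : ℕ → ℕ) (i k : ℕ) :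
    column i ((List.range (Nat.pair i k)).map X) =
      (List.range k).map fun l => X (Nat.pair i l) :=
  column_map_range X i _ k (Nat.right_le_pair i k) fun l =>
    ⟨fun h => by
      by_contra hl
      rcases (not_lt.1 hl).lt_or_eq with h' | rfl
      · exact absurd (Nat.pair_lt_pair_right i h') (by omega)
      · omega,
     fun h => Nat.pair_lt_pair_right i h⟩

theorem exists_column_map_range (X : ℕ → ℕ) (i n : ℕ) :
    ∃ k, column i ((List.range n).map X) = (List.range k).map fun l => X (Nat.pair i l) := by
  have hex : ∃ k, n ≤ Nat.pair i k := ⟨n, Nat.right_le_pair i n⟩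
  refine ⟨Nat.find hex, column_map_range X i n _
    (Nat.find_min' hex (Nat.right_le_pair i n)) fun l => ⟨fun h => ?_, fun h => ?_⟩⟩
  · by_contra hl
    have h2 := Nat.find_spec hex
    rcases (not_lt.1 hl).lt_or_eq with h' | h'
    · have := Nat.pair_lt_pair_right i h'
      omega
    · rw [h'] at h2
      omega
  · exact not_le.1 (Nat.find_min hex h)

/-- The `i`-th coordinate of a path through a product of trees. -/
def prodProj {T : ℕ → Set (List ℕ)} (X : Paths (prodTree T)) (i : ℕ) : Paths (T i) :=
  ⟨fun l => X.1 (Nat.pair i l), fun k => by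
    have h := X.2 (Nat.pair i k) i
    rwa [column_map_range_pair] at h⟩

/-- The path through a product of trees that is spliced together from paths through the factors. -/
def prodSplice {T : ℕ → Set (List ℕ)} (Y : (i : ℕ) → Paths (T i)) : Paths (prodTree T) :=
  ⟨fun m => (Y m.unpair.1).1 m.unpair.2, fun n i => by
    obtain ⟨k, hk⟩ := exists_column_map_range (fun m => (Y m.unpair.1).1 m.unpair.2) i n
    rw [hk]
    have key : ∀ (l : ℕ) (q : ℕ × ℕ), q = (i, l) → (Y q.1).1 q.2 = (Y i).1 l := by
      rintro l _ rfl
      rfl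
    rw [List.map_congr_left fun l _ => key l _ (Nat.unpair_pair i l)]
    exact (Y i).2 k⟩

/-- The infinite Cartesian product of a sequence of trees with structures, the operations being
computed in each coordinate. -/
def TreeStructure.prod (A : ℕ → TreeStructure) : TreeStructure where
  tree := prodTree fun i => (A i).tree
  str :=
    { funMap := fun f X => prodSplice fun i =>
        FirstOrder.Language.Structure.funMap (M := (A i).Dom) f fun j => prodProj (X j) i
      RelMap := fun r _ => r.elim }

/-! ### The presentation of the additive group of `p`-adic integers -/

/-- The tree of the strings `(k₁, …, kₙ)` with `kᵢ < p ^ i` and `kᵢ₊₁ ≡ kᵢ` modulo `p ^ i`; the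
entry `kᵢ` has index `i - 1` in the list. -/
def padicTree (p : ℕ) : Set (List ℕ) :=
  {σ | (∀ i < σ.length, σ.getD i 0 < p ^ (i + 1)) ∧
    ∀ i, i + 1 < σ.length → σ.getD (i + 1) 0 ≡ σ.getD i 0 [MOD p ^ (i + 1)]}

theorem mem_paths_padicTree (p : ℕ) (X : ℕ → ℕ) :
    (∀ n, (List.range n).map X ∈ padicTree p) ↔
      (∀ i, X i < p ^ (i + 1)) ∧ ∀ i, X (i + 1) ≡ X i [MOD p ^ (i + 1)] := by
  constructor
  · intro h
    refine ⟨fun i => ?_, fun i => ?_⟩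
    · simpa [List.getD] using (h (i + 1)).1 i (by simp)
    · simpa [List.getD] using (h (i + 2)).2 i (by simp)
  · rintro ⟨h1, h2⟩ n
    refine ⟨fun i hi => ?_, fun i hi => ?_⟩
    · have hi' : i < n := by simpa using hi
      simpa [List.getD, hi'] using h1 i
    · have hi' : i + 1 < n := by simpa using hi
      simpa [List.getD, hi', (Nat.lt_succ_self i).trans hi'] using h2 i

/-- The path of the tree `padicTree p` given by a sequence of representatives. -/
def padicPath (p : ℕ) (hp : 0 < p) (x : ℕ → ℕ)
    (hx : ∀ i, x (i + 1) ≡ x i [MOD p ^ (i + 1)]) : Paths (padicTree p) :=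
  ⟨fun i => x i % p ^ (i + 1), (mem_paths_padicTree p _).2
    ⟨fun i => Nat.mod_lt _ (pow_pos hp _), fun i =>
      (((Nat.mod_modEq _ _).of_dvd (pow_dvd_pow p (Nat.le_succ _))).trans (hx i)).trans
        (Nat.mod_modEq _ _).symm⟩⟩

theorem padic_neg_modEq {a b m p : ℕ} (ha : a ≤ m * p) (hb : b ≤ m) (h : a ≡ b [MOD m]) :
    m * p - a ≡ m - b [MOD m] := by
  refine Nat.ModEq.add_right_cancel h ?_
  rw [Nat.sub_add_cancel ha, Nat.sub_add_cancel hb]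
  simp [Nat.ModEq]

/-- The tree presentation of the additive group of the `p`-adic integers: zero is `(0, 0, …)`, and
negation and addition are computed modulo `p ^ i` in the `i`-th coordinate, for `i = 1, 2, …`. -/
def padicTreeStructure (p : Nat.Primes) : TreeStructure where
  tree := padicTree p
  str := addGroupLang.mkStructure
    (padicPath p p.2.pos (fun _ => 0) fun _ => Nat.ModEq.refl _)
    (fun X => padicPath p p.2.pos (fun i => (p : ℕ) ^ (i + 1) - X.1 i) fun i => by
      obtain ⟨h1, h2⟩ := (mem_paths_padicTree p X.1).1 X.2
      have := padic_neg_modEq (m := (p : ℕ) ^ (i + 1)) (p := p)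
        (by rw [← pow_succ]; exact (h1 (i + 1)).le) (h1 i).le (h2 i)
      rwa [← pow_succ] at this)
    (fun X Y => padicPath p p.2.pos (fun i => X.1 i + Y.1 i) fun i =>
      (((mem_paths_padicTree p X.1).1 X.2).2 i).add (((mem_paths_padicTree p Y.1).1 Y.2).2 i))

/-! ### The profinite completion of the integers -/

/-- The profinite completion of the additive group `ℤ`. -/
abbrev ZHat : Type :=
  ProfiniteAddGrp.ProfiniteCompletion.completion (AddGrpCat.of ℤ)

/-- The additive group of the profinite completion of `ℤ` as a first-order structure. -/
noncomputable instance zHatGroupStructure : addGroupLang.Structure ZHat :=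
  addGroupLang.mkStructure 0 (fun x => -x) (fun x y => x + y)

/-- The infinite Cartesian product, over the primes in increasing order, of the tree presentations
of the additive groups of `p`-adic integers. -/
noncomputable def zHatTreeStructure : TreeStructure :=
  TreeStructure.prod fun i => padicTreeStructure ⟨Nat.nth Nat.Prime i, Nat.prime_nth_prime i⟩

/-! ### Compatible systems of residues -/

/-! Everything is transferred to one concrete group R, the compatible systems of residues modulo all
positive integers. Paths of the tree are the elements of R by the Chinese remainder theorem, and R
is the profinite completion because the finite-index subgroups of ℤ are exactly the mℤ with m > 0.
Two facts about R carry the rest. It is torsion-free (`eq_zero_of_zsmul_eq_zero`), and for c ≠ 0 an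
element is divisible by c as soon as its residue modulo |c| vanishes (`exists_zsmul_eq`).

Decidability rests on a back-and-forth between R and ℤ. Call tuples N-similar if they agree modulo
N! and satisfy the same linear relations with coefficients at most N. If two tuples are 2N²-similar,
then any new entry on one side can be matched on the other so that the longer tuples are N-similar
(`Similar.exists_extend`). Either the new entry depends on the old ones by a relation with small
coefficients, and the same relation can be solved on the other side by divisibility, or it is
generic, and its match only needs the right residue and must avoid finitely many relations. A match
in ℤ can moreover be bounded explicitly (`Similar.exists_int`), so truth in R becomes truth in ℤ
with bounded quantifiers, which is primitive recursive (`formulaVal_iff`).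

Every tuple of R is similar to an integer tuple at any prescribed level (`exists_similar_ints`), and
this can be recognised from the oracle. Residues are read off the paths, a nonzero linear form shows
a nonzero residue at some finite place, and a vanishing one appears in the enumeration of the
positive atomic diagram. The decision procedure searches for a certified integer tuple and evaluates
the formula there.

For an equation ∑ aᵢFᵢ = bG with b ≠ 0, solvability means that the left side vanishes modulo |b|.
This is a condition on finitely many digits, hence clopen (`solvableMod_iff`). Torsion-freeness
makes G unique. Its digits come from solving the equation modulo a higher prime power, since
cancelling b loses a bounded number of digits (`solution_spec`). -/

/-- The group of the compatible systems of residues modulo the positive integers. -/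
def residueSystems : AddSubgroup (∀ m : ℕ+, ZMod m) where
  carrier := {f | ∀ (m k : ℕ+) (h : (m : ℕ) ∣ k), ZMod.castHom h (ZMod m) (f k) = f m}
  zero_mem' := fun m k h => by simp
  add_mem' := fun {f g} hf hg m k h => by
    rw [Pi.add_apply, map_add, hf m k h, hg m k h, Pi.add_apply]
  neg_mem' := fun {f} hf m k h => by rw [Pi.neg_apply, map_neg, hf m k h, Pi.neg_apply]

namespace residueSystems

/-- The residue modulo `m` of a compatible system. -/
def proj (m : ℕ) [NeZero m] : residueSystems →+ ZMod m where
  toFun f := f.1 ⟨m, NeZero.pos m⟩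
  map_zero' := rfl
  map_add' _ _ := rfl

theorem castHom_proj {m k : ℕ} [NeZero m] [NeZero k] (h : m ∣ k) (f : residueSystems) :
    ZMod.castHom h (ZMod m) (proj k f) = proj m f :=
  f.2 ⟨m, NeZero.pos m⟩ ⟨k, NeZero.pos k⟩ h

theorem ext {f g : residueSystems} (h : ∀ (m : ℕ) [NeZero m], proj m f = proj m g) : f = g :=
  Subtype.ext <| funext fun m => by
    have : NeZero (m : ℕ) := ⟨m.ne_zero⟩
    exact h m

/-- The compatible system given by a sequence of representatives. -/
def ofInt (x : ℕ → ℤ) (hx : ∀ m k : ℕ, k ≠ 0 → m ∣ k → (m : ℤ) ∣ x k - x m) : residueSystems :=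
  ⟨fun m => (x m : ZMod m), fun m k h => by
    rw [map_intCast, eq_comm, ZMod.intCast_eq_intCast_iff_dvd_sub]
    exact hx m k k.ne_zero h⟩

@[simp]
theorem proj_ofInt (x : ℕ → ℤ) (hx) (m : ℕ) [NeZero m] : proj m (ofInt x hx) = x m := rfl

/-- The constant systems. -/
def int : ℤ →+ residueSystems where
  toFun r := ofInt (fun _ => r) fun _ _ _ _ => by simp
  map_zero' := ext fun m _ => by simp
  map_add' r s := ext fun m _ => by simp

@[simp]
theorem proj_int (r : ℤ) (m : ℕ) [NeZero m] : proj m (int r) = r := rfl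

theorem zsmul_int (a r : ℤ) : a • int r = int (a * r) := by
  rw [← map_zsmul, smul_eq_mul]

/-- Integer representatives turn statements about residues into divisibility in ℤ, where one can
divide by c. -/
theorem exists_rep (f : residueSystems) : ∃ x : ℕ → ℤ,
    (∀ m k : ℕ, k ≠ 0 → m ∣ k → (m : ℤ) ∣ x k - x m) ∧ ∀ (m : ℕ) [NeZero m], proj m f = x m := by
  classical
  -- The value at 0 is a default: if `m ∣ k` and `k ≠ 0`, then neither index is 0.
  let x : ℕ → ℤ := fun m => if h : 0 < m then ((f.1 ⟨m, h⟩).val : ℤ) else 0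
  have key : ∀ (m : ℕ) [NeZero m], proj m f = x m := fun m _ => by
    simp only [x, dif_pos (NeZero.pos m)]
    rw [Int.cast_natCast]
    exact (ZMod.natCast_zmod_val (proj m f)).symm
  refine ⟨x, fun m k hk h => ?_, key⟩
  have : NeZero k := ⟨hk⟩
  have : NeZero m := ⟨fun h0 => hk (by simpa [h0] using h)⟩
  rw [← ZMod.intCast_eq_intCast_iff_dvd_sub, ← key m, ← castHom_proj h f, key k, map_intCast]

theorem proj_eq_iff_of_rep {f : residueSystems} {x : ℕ → ℤ}
    (hx : ∀ (m : ℕ) [NeZero m], proj m f = x m) {m : ℕ} [NeZero m] {r : ℤ} :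
    proj m f = r ↔ (m : ℤ) ∣ r - x m := by
  rw [hx, ZMod.intCast_eq_intCast_iff_dvd_sub]

/-- All representatives at indices |c|k are multiples of c, because they agree with the one at |c|
modulo |c|. The quotient is read at m as the representative at |c|m divided by c. -/
theorem exists_zsmul_eq {c : ℤ} [NeZero c.natAbs] {f : residueSystems}
    (h : proj c.natAbs f = 0) : ∃ w : residueSystems, c • w = f := by
  obtain ⟨x, hx, hp⟩ := exists_rep f
  have hc : c ≠ 0 := Int.natAbs_ne_zero.1 (NeZero.ne _)
  have hdiv : ∀ k : ℕ, k ≠ 0 → c ∣ x (c.natAbs * k) := fun k hk => by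
    have h1 := hx c.natAbs (c.natAbs * k) (mul_ne_zero (NeZero.ne _) hk) (dvd_mul_right _ _)
    have h2 : ((c.natAbs : ℕ) : ℤ) ∣ x c.natAbs := by
      rw [hp] at h
      exact (ZMod.intCast_zmod_eq_zero_iff_dvd _ _).1 h
    rw [Int.natAbs_dvd] at h1 h2
    exact (dvd_sub_left h2).1 h1
  refine ⟨ofInt (fun k => x (c.natAbs * k) / c) fun m k hk hmk => ?_, ext fun m _ => ?_⟩
  · have hm : m ≠ 0 := fun h0 => hk (by simpa [h0] using hmk)
    have h1 := hx (c.natAbs * m) (c.natAbs * k) (mul_ne_zero (NeZero.ne _) hk)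
      (Nat.mul_dvd_mul_left _ hmk)
    obtain ⟨u, hu⟩ := hdiv k hk
    obtain ⟨v, hv⟩ := hdiv m hm
    simp only [hu, hv, Int.mul_ediv_cancel_left _ hc] at h1 ⊢
    rw [← mul_sub, Nat.cast_mul] at h1
    refine Int.dvd_of_mul_dvd_mul_left (a := c) hc ?_
    refine (mul_dvd_mul_right ?_ _).trans h1
    exact Int.dvd_natAbs.2 dvd_rfl
  · rw [map_zsmul, proj_ofInt, zsmul_eq_mul, ← Int.cast_mul,
      Int.mul_ediv_cancel' (hdiv m (NeZero.ne m)), eq_comm, proj_eq_iff_of_rep hp]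
    exact hx m _ (mul_ne_zero (NeZero.ne _) (NeZero.ne _)) (dvd_mul_left _ _)

/-- Cancelling c costs exactly the factor |c| in the modulus. Torsion-freeness follows by letting m
vary. -/
theorem proj_eq_zero_of_zsmul {c : ℤ} {m : ℕ} [NeZero m] [NeZero (c.natAbs * m)]
    {f : residueSystems} (h : proj (c.natAbs * m) (c • f) = 0) : proj m f = 0 := by
  obtain ⟨x, hx, hp⟩ := exists_rep f
  have hc : c ≠ 0 := by
    rintro rfl
    exact NeZero.ne (Int.natAbs 0 * m) (by simp)
  rw [map_zsmul, hp, zsmul_eq_mul, ← Int.cast_mul, ZMod.intCast_zmod_eq_zero_iff_dvd,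
    Nat.cast_mul] at h
  have h1 : (m : ℤ) ∣ x (c.natAbs * m) := by
    refine Int.dvd_of_mul_dvd_mul_left (a := c) hc ?_
    exact (mul_dvd_mul_right (Int.dvd_natAbs.2 dvd_rfl) _).trans h
  have h2 := hx m (c.natAbs * m) (NeZero.ne _) (dvd_mul_left _ _)
  rw [hp, ZMod.intCast_zmod_eq_zero_iff_dvd]
  exact (dvd_sub_right h1).1 h2

theorem eq_zero_of_zsmul_eq_zero {c : ℤ} (hc : c ≠ 0) {f : residueSystems} (h : c • f = 0) :
    f = 0 := ext fun m _ => by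
  have : NeZero (c.natAbs * m) := ⟨mul_ne_zero (Int.natAbs_ne_zero.2 hc) (NeZero.ne _)⟩
  rw [map_zero]
  exact proj_eq_zero_of_zsmul (c := c) (by rw [h, map_zero])

theorem zsmul_injective {c : ℤ} (hc : c ≠ 0) {f g : residueSystems} (h : c • f = c • g) : f = g :=
  sub_eq_zero.1 (eq_zero_of_zsmul_eq_zero hc (by rw [zsmul_sub, h, sub_self]))

theorem int_injective : Function.Injective int := fun r s h => by
  by_contra hne
  have h0 : r - s ≠ 0 := sub_ne_zero.2 hne
  -- The modulus |r - s| + 1 is too large to divide the nonzero difference.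
  have := congrArg (proj (r - s).natAbs.succ) (sub_eq_zero.2 h)
  rw [← map_sub, proj_int, map_zero, ZMod.intCast_zmod_eq_zero_iff_dvd, Int.natCast_dvd] at this
  exact absurd (Nat.le_of_dvd (Int.natAbs_pos.2 h0) this) (by omega)

theorem int_eq_zero {r : ℤ} : int r = 0 ↔ r = 0 :=
  ⟨fun h => int_injective (by rw [h, map_zero]), fun h => by rw [h, map_zero]⟩

theorem proj_eq_intCast_of_dvd {m k : ℕ} [NeZero m] [NeZero k] (h : m ∣ k) {f : residueSystems}
    {r : ℤ} (hf : proj k f = r) : proj m f = r := by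
  rw [← castHom_proj h f, hf, map_intCast]

theorem exists_proj_eq (m : ℕ) [NeZero m] (f : residueSystems) :
    ∃ r : ℕ, r < m ∧ proj m f = ((r : ℤ) : ZMod m) :=
  ⟨(proj m f).val, ZMod.val_lt _, by simp⟩

/-! ### Reduction to prime-power moduli -/

/-- The `(l + 1)`-st power of the `i`-th prime number. -/
noncomputable def _root_.nthPrimePow (i l : ℕ) : ℕ := Nat.nth Nat.Prime i ^ (l + 1)

instance _root_.nthPrimePow_neZero (i l : ℕ) : NeZero (nthPrimePow i l) :=
  ⟨pow_ne_zero _ (Nat.prime_nth_prime i).ne_zero⟩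

theorem _root_.nthPrimePow_dvd (i : ℕ) {l k : ℕ} (h : l ≤ k) :
    nthPrimePow i l ∣ nthPrimePow i k := pow_dvd_pow _ (Nat.succ_le_succ h)

theorem _root_.Int.dvd_of_nthPrimePow {m : ℕ} {r : ℤ}
    (h : ∀ i l, nthPrimePow i l ∣ m → (nthPrimePow i l : ℤ) ∣ r) : (m : ℤ) ∣ r := by
  rw [Int.natCast_dvd, Nat.dvd_iff_prime_pow_dvd_dvd]
  rintro p (_ | l) hp hd
  · simp
  · obtain ⟨i, rfl⟩ : ∃ i, Nat.nth Nat.Prime i = p := by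
      have := Nat.range_nth_of_infinite Nat.infinite_setOfPred_prime
      exact this.ge hp
    exact Int.natCast_dvd.1 (h i l hd)

/-- The uniqueness half of the Chinese remainder theorem: an integer is divisible by m once all
prime powers dividing m divide it. -/
theorem proj_eq_intCast_iff {m : ℕ} [NeZero m] {f : residueSystems} {r : ℤ} :
    proj m f = r ↔ ∀ i l, nthPrimePow i l ∣ m → proj (nthPrimePow i l) f = r := by
  refine ⟨fun h i l hd => proj_eq_intCast_of_dvd hd h, fun h => ?_⟩
  obtain ⟨x, hx, hp⟩ := exists_rep f
  rw [proj_eq_iff_of_rep hp]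
  refine Int.dvd_of_nthPrimePow fun i l hd => ?_
  have h1 := (proj_eq_iff_of_rep hp).1 (h i l hd)
  have h2 := hx _ _ (NeZero.ne m) hd
  have := dvd_sub h1 h2
  have e : r - x m = (r - x (nthPrimePow i l)) - (x m - x (nthPrimePow i l)) := by ring
  rwa [e]

theorem ext_nthPrimePow {f g : residueSystems}
    (h : ∀ i l, proj (nthPrimePow i l) f = proj (nthPrimePow i l) g) : f = g := by
  rw [← sub_eq_zero]
  refine ext fun m _ => ?_
  rw [map_zero, ← Int.cast_zero, proj_eq_intCast_iff]
  intro i l _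
  rw [map_sub, h, sub_self, Int.cast_zero]

end residueSystems

/-! ### The group of compatible systems as a structure -/

instance : addGroupLang.Structure residueSystems :=
  addGroupLang.mkStructure 0 (fun x => -x) (fun x y => x + y)

theorem mem_paths_zHatTree (X : ℕ → ℕ) :
    (∀ n, (List.range n).map X ∈ zHatTreeStructure.tree) ↔
      (∀ i l, X (Nat.pair i l) < nthPrimePow i l) ∧
        ∀ i l, X (Nat.pair i (l + 1)) ≡ X (Nat.pair i l) [MOD nthPrimePow i l] := by
  constructor
  · intro h
    have key := fun i => (mem_paths_padicTree _ _).1 (prodProj ⟨X, h⟩ i).2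
    exact ⟨fun i => (key i).1, fun i => (key i).2⟩
  · rintro ⟨h1, h2⟩ n i
    obtain ⟨k, hk⟩ := exists_column_map_range X i n
    rw [hk]
    exact (mem_paths_padicTree _ _).2 ⟨h1 i, h2 i⟩ k

/-- This makes quantification over the prime powers dividing m a bounded one, both for the Chinese
remainder theorem and for the computable certificates. -/
theorem lt_of_nthPrimePow_dvd {m i l : ℕ} (hm : m ≠ 0) (hd : nthPrimePow i l ∣ m) :
    i < m ∧ l < m := by
  have hle := Nat.le_of_dvd (Nat.pos_of_ne_zero hm) hd
  have hp := (Nat.prime_nth_prime i).two_le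
  have hl : l < m := ((Nat.lt_succ_self l).trans (Nat.lt_pow_self hp)).trans_le hle
  refine ⟨?_, hl⟩
  have h1 : i < Nat.nth Nat.Prime i := by
    have := Nat.add_two_le_nth_prime i
    omega
  exact (h1.trans_le (Nat.le_self_pow (Nat.succ_ne_zero l) _)).trans_le hle

/-! ### Paths of the tree as compatible systems of residues -/

namespace zHatTreeStructure

theorem ext_path {X Y : zHatTreeStructure.Dom}
    (h : ∀ i l, X.1 (Nat.pair i l) = Y.1 (Nat.pair i l)) : X = Y :=
  Subtype.ext <| funext fun k => by simpa using h k.unpair.1 k.unpair.2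

theorem path_lt (X : zHatTreeStructure.Dom) (i l : ℕ) : X.1 (Nat.pair i l) < nthPrimePow i l :=
  ((mem_paths_zHatTree X.1).1 X.2).1 i l

theorem funMap_zero (X : Fin 0 → zHatTreeStructure.Dom) (i l : ℕ) :
    (FirstOrder.Language.Structure.funMap (L := addGroupLang) AddGroupFunc.zero X).1
      (Nat.pair i l) = 0 := by
  change 0 % _ = 0
  exact Nat.zero_mod _

theorem funMap_neg (X : Fin 1 → zHatTreeStructure.Dom) (i l : ℕ) :
    (FirstOrder.Language.Structure.funMap (L := addGroupLang) AddGroupFunc.neg X).1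
      (Nat.pair i l) = (nthPrimePow i l - (X 0).1 (Nat.pair i l)) % nthPrimePow i l := by
  have : ∀ q : ℕ × ℕ, q = (i, l) →
      (nthPrimePow q.1 q.2 - (X 0).1 (Nat.pair q.1 q.2)) % nthPrimePow q.1 q.2 =
      (nthPrimePow i l - (X 0).1 (Nat.pair i l)) % nthPrimePow i l := by
    rintro _ rfl
    rfl
  exact this _ (Nat.unpair_pair i l)

theorem funMap_add (X : Fin 2 → zHatTreeStructure.Dom) (i l : ℕ) :
    (FirstOrder.Language.Structure.funMap (L := addGroupLang) AddGroupFunc.add X).1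
      (Nat.pair i l) =
      ((X 0).1 (Nat.pair i l) + (X 1).1 (Nat.pair i l)) % nthPrimePow i l := by
  have : ∀ q : ℕ × ℕ, q = (i, l) →
      ((X 0).1 (Nat.pair q.1 q.2) + (X 1).1 (Nat.pair q.1 q.2)) % nthPrimePow q.1 q.2 =
      ((X 0).1 (Nat.pair i l) + (X 1).1 (Nat.pair i l)) % nthPrimePow i l := by
    rintro _ rfl
    rfl
  exact this _ (Nat.unpair_pair i l)

/-- The modulus occurs in the type of the residue, so unpairing cannot simply be rewritten.
Generalizing over the pair allows the equation to be eliminated. -/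
theorem residueVal_pair (f : residueSystems) (i l : ℕ) :
    (residueSystems.proj
      (nthPrimePow (Nat.pair i l).unpair.1 (Nat.pair i l).unpair.2) f).val =
      (residueSystems.proj (nthPrimePow i l) f).val := by
  have : ∀ q : ℕ × ℕ, q = (i, l) → (residueSystems.proj (nthPrimePow q.1 q.2) f).val =
      (residueSystems.proj (nthPrimePow i l) f).val := by
    rintro _ rfl
    rfl
  exact this _ (Nat.unpair_pair i l)

/-- The path of a compatible system of residues. -/
noncomputable def ofResidueSystem (f : residueSystems) : zHatTreeStructure.Dom :=
  ⟨fun k => (residueSystems.proj (nthPrimePow k.unpair.1 k.unpair.2) f).val,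
    (mem_paths_zHatTree _).2 ⟨fun i l => by
      rw [residueVal_pair]
      exact ZMod.val_lt _, fun i l => by
      rw [residueVal_pair, residueVal_pair]
      rw [← ZMod.natCast_eq_natCast_iff, ZMod.natCast_zmod_val,
        ← residueSystems.castHom_proj (nthPrimePow_dvd i l.le_succ), ZMod.castHom_apply,
        ZMod.natCast_val]⟩⟩

theorem ofResidueSystem_apply (f : residueSystems) (i l : ℕ) :
    (ofResidueSystem f).1 (Nat.pair i l) = (residueSystems.proj (nthPrimePow i l) f).val :=
  residueVal_pair f i l

theorem ofResidueSystem_injective : Function.Injective ofResidueSystem := fun f g h => by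
  refine residueSystems.ext_nthPrimePow fun i l => ZMod.val_injective _ ?_
  rw [← ofResidueSystem_apply, h, ofResidueSystem_apply]

theorem modEq_of_le (X : zHatTreeStructure.Dom) (i : ℕ) {l k : ℕ} (h : l ≤ k) :
    X.1 (Nat.pair i k) ≡ X.1 (Nat.pair i l) [MOD nthPrimePow i l] := by
  induction k, h using Nat.le_induction with
  | base => rfl
  | succ k h ih =>
    exact ((((mem_paths_zHatTree X.1).1 X.2).2 i k).of_dvd (nthPrimePow_dvd i h)).trans ih

/-- The Chinese remainder theorem is applied to the first m primes, each with exponent m + 1. This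
covers every prime power dividing m. -/
theorem exists_residue (X : zHatTreeStructure.Dom) {m : ℕ} (hm : m ≠ 0) :
    ∃ r : ℕ, ∀ i l, nthPrimePow i l ∣ m → r ≡ X.1 (Nat.pair i l) [MOD nthPrimePow i l] := by
  classical
  obtain ⟨r, hr⟩ := Nat.chineseRemainderOfFinset
    (fun i => X.1 (Nat.pair i m)) (fun i => nthPrimePow i m) (Finset.range m)
    (fun i _ => NeZero.ne _) (fun i _ j _ hij => by
      refine Nat.Coprime.pow _ _ ((Nat.coprime_primes (Nat.prime_nth_prime i)
        (Nat.prime_nth_prime j)).2 fun h => hij ?_)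
      exact Nat.nth_injective Nat.infinite_setOfPred_prime h)
  refine ⟨r, fun i l hd => ?_⟩
  obtain ⟨hi, hl⟩ := lt_of_nthPrimePow_dvd hm hd
  exact ((hr i (Finset.mem_range.2 hi)).of_dvd (nthPrimePow_dvd i hl.le)).trans
    (modEq_of_le X i hl.le)

theorem ofResidueSystem_surjective : Function.Surjective ofResidueSystem := fun X => by
  classical
  choose! r hr using fun m : ℕ => exists_residue X (m := m)
  refine ⟨residueSystems.ofInt (fun m => r m) fun m k hk hmk => ?_, ext_path fun i l => ?_⟩
  · have hm : m ≠ 0 := fun h0 => hk (by simpa [h0] using hmk)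
    refine Int.dvd_of_nthPrimePow fun i l hd => ?_
    exact Nat.modEq_iff_dvd.1 ((hr m hm i l hd).trans (hr k hk i l (hd.trans hmk)).symm)
  · rw [ofResidueSystem_apply, residueSystems.proj_ofInt, Int.cast_natCast, ZMod.val_natCast]
    exact Nat.mod_eq_of_modEq (hr _ (NeZero.ne _) i l dvd_rfl) (path_lt X i l)

/-- The structure on the paths is isomorphic to the group of compatible systems of residues. -/
noncomputable def equivResidueSystems : residueSystems ≃[addGroupLang] zHatTreeStructure.Dom where
  toEquiv := Equiv.ofBijective ofResidueSystem
    ⟨ofResidueSystem_injective, ofResidueSystem_surjective⟩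
  map_fun' := fun f x => by
    refine ext_path fun i l => ?_
    change (ofResidueSystem _).1 _ = _
    rw [ofResidueSystem_apply]
    cases f with
    | zero =>
      rw [funMap_zero]
      exact ZMod.val_zero
    | neg =>
      rw [funMap_neg]
      change ZMod.val (residueSystems.proj _ (-x 0)) =
        (nthPrimePow i l - (ofResidueSystem (x 0)).1 _) % _
      rw [map_neg, ofResidueSystem_apply, ZMod.neg_val']
    | add =>
      rw [funMap_add]
      change ZMod.val (residueSystems.proj _ (x 0 + x 1)) =
        ((ofResidueSystem (x 0)).1 _ + (ofResidueSystem (x 1)).1 _) % _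
      rw [map_add, ofResidueSystem_apply, ofResidueSystem_apply, ZMod.val_add]
  map_rel' := fun r => r.elim

theorem equivResidueSystems_apply (f : residueSystems) (i l : ℕ) :
    (equivResidueSystems f).1 (Nat.pair i l) = (residueSystems.proj (nthPrimePow i l) f).val :=
  ofResidueSystem_apply f i l

theorem proj_eq_path {f : residueSystems} {X : zHatTreeStructure.Dom}
    (h : equivResidueSystems f = X) (i l : ℕ) :
    residueSystems.proj (nthPrimePow i l) f = (X.1 (Nat.pair i l) : ZMod (nthPrimePow i l)) := by
  rw [← h, equivResidueSystems_apply, ZMod.natCast_zmod_val]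

end zHatTreeStructure

/-! ### The profinite completion -/

namespace ZHat

open ProfiniteAddGrp.ProfiniteCompletion

/-- The subgroup of the multiples of a positive integer. -/
def multiples (m : ℕ+) : FiniteIndexNormalAddSubgroup (AddGrpCat.of ℤ) where
  toAddSubgroup := AddSubgroup.zmultiples (m : ℤ)
  isNormal' := inferInstance
  isFiniteIndex' := ⟨by
    change (AddSubgroup.zmultiples (m : ℤ)).index ≠ 0
    rw [Int.index_zmultiples]
    simp⟩

/-- Subgroups of ℤ are cyclic, and finite index forces a nonzero generator. -/
theorem exists_eq_multiples (U : FiniteIndexNormalAddSubgroup (AddGrpCat.of ℤ)) :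
    ∃ m, U = multiples m := by
  obtain ⟨a, ha⟩ := Int.subgroup_cyclic (show AddSubgroup ℤ from U.toAddSubgroup)
  rw [← AddSubgroup.zmultiples_eq_closure] at ha
  have h0 := U.isFiniteIndex'.index_ne_zero
  change (show AddSubgroup ℤ from U.toAddSubgroup).index ≠ 0 at h0
  rw [ha, Int.index_zmultiples] at h0
  refine ⟨⟨a.natAbs, Nat.pos_of_ne_zero h0⟩, FiniteIndexNormalAddSubgroup.ext ?_⟩
  change (U.toAddSubgroup : Set ℤ) = (AddSubgroup.zmultiples ((a.natAbs : ℕ) : ℤ) : Set ℤ)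
  rw [Int.zmultiples_natAbs, ← ha]

/-- The index of a subgroup of finite index. -/
noncomputable def index (U : FiniteIndexNormalAddSubgroup (AddGrpCat.of ℤ)) : ℕ :=
  U.toAddSubgroup.index

instance (U : FiniteIndexNormalAddSubgroup (AddGrpCat.of ℤ)) : NeZero (index U) :=
  ⟨U.isFiniteIndex'.index_ne_zero⟩

theorem index_multiples (m : ℕ+) : index (multiples m) = m := by
  change (AddSubgroup.zmultiples ((m : ℕ) : ℤ)).index = m
  rw [Int.index_zmultiples]
  simp

theorem mem_iff_index_dvd (U : FiniteIndexNormalAddSubgroup (AddGrpCat.of ℤ)) (x : ℤ) :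
    (show AddGrpCat.of ℤ from x) ∈ U.toAddSubgroup ↔ (index U : ℤ) ∣ x := by
  obtain ⟨m, rfl⟩ := exists_eq_multiples U
  rw [index_multiples]
  exact Int.mem_zmultiples_iff

/-- The class of an integer modulo a subgroup. -/
def mk (U : FiniteIndexNormalAddSubgroup (AddGrpCat.of ℤ)) (x : ℤ) :
    (AddGrpCat.of ℤ) ⧸ U.toAddSubgroup :=
  QuotientAddGroup.mk (show AddGrpCat.of ℤ from x)

theorem mk_eq_mk {U : FiniteIndexNormalAddSubgroup (AddGrpCat.of ℤ)} {x y : ℤ} :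
    mk U x = mk U y ↔ (x : ZMod (index U)) = y := by
  rw [ZMod.intCast_eq_intCast_iff_dvd_sub, sub_eq_neg_add, ← mem_iff_index_dvd]
  exact QuotientAddGroup.eq

open residueSystems in
/-- The element of the profinite completion given by a compatible system of residues. -/
noncomputable def ofResidueSystem (f : residueSystems) : ZHat :=
  ⟨fun U => mk U ((exists_rep f).choose (index U)), fun U V h => by
    change mk V _ = mk V _
    obtain ⟨hx, hp⟩ := (exists_rep f).choose_spec
    have hdvd : index V ∣ index U := AddSubgroup.index_dvd_of_le h.le
    rw [mk_eq_mk, ← hp (index V)]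
    exact (proj_eq_intCast_of_dvd hdvd (hp _)).symm⟩

/-- Any integer with the right residue may replace the chosen representative. All later computations
use this instead of the choice. -/
theorem ofResidueSystem_eq_mk {f : residueSystems}
    {U : FiniteIndexNormalAddSubgroup (AddGrpCat.of ℤ)} {r : ℤ}
    (h : residueSystems.proj (index U) f = r) : (ofResidueSystem f).1 U = mk U r := by
  change mk U _ = mk U r
  rw [mk_eq_mk, ← h, (residueSystems.exists_rep f).choose_spec.2]

theorem ofResidueSystem_injective : Function.Injective ofResidueSystem := fun f g h => by
  refine residueSystems.ext fun m hm => ?_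
  obtain ⟨n, rfl⟩ : ∃ n : ℕ+, m = n := ⟨⟨m, hm.pos⟩, rfl⟩
  obtain ⟨r, hr, hf⟩ := residueSystems.exists_proj_eq (index (multiples n)) f
  obtain ⟨s, hs, hg⟩ := residueSystems.exists_proj_eq (index (multiples n)) g
  have h1 : mk (multiples n) s = mk (multiples n) r := by
    refine (ofResidueSystem_eq_mk hg).symm.trans (Eq.trans ?_ (ofResidueSystem_eq_mk hf))
    rw [h]
  have hn : (n : ℕ) ∣ index (multiples n) := by rw [index_multiples]
  rw [residueSystems.proj_eq_intCast_of_dvd hn (hf.trans (mk_eq_mk.1 h1).symm),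
    residueSystems.proj_eq_intCast_of_dvd hn hg]

theorem ofResidueSystem_surjective : Function.Surjective ofResidueSystem := fun ξ => by
  have hex : ∀ U, ∃ x : ℤ, mk U x = ξ.1 U := fun U => QuotientAddGroup.mk_surjective (ξ.1 U)
  choose x hx using hex
  classical
  let y : ℕ → ℤ := fun m => if h : 0 < m then x (multiples ⟨m, h⟩) else 0
  have hy : ∀ m : ℕ+, y m = x (multiples m) := fun m => dif_pos m.pos
  -- This is the compatibility of `ξ` with the transition map of the inclusion.
  have hproj : ∀ {U V : FiniteIndexNormalAddSubgroup (AddGrpCat.of ℤ)}, U ≤ V →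
      mk V (x U) = mk V (x V) := fun {U V} hUV => by
    rw [hx V, ← ξ.2 (CategoryTheory.homOfLE hUV), ← hx U]
    rfl
  refine ⟨residueSystems.ofInt y fun m k hk hmk => ?_, Subtype.ext (funext fun U => ?_)⟩
  · have hm : m ≠ 0 := fun h0 => hk (by simpa [h0] using hmk)
    lift k to ℕ+ using Nat.pos_of_ne_zero hk
    lift m to ℕ+ using Nat.pos_of_ne_zero hm
    have hle : multiples k ≤ multiples m := fun a ha =>
      Int.mem_zmultiples_iff.2 ((Int.natCast_dvd_natCast.2 hmk).trans (Int.mem_zmultiples_iff.1 ha))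
    have := mk_eq_mk.1 (hproj hle)
    rw [index_multiples, eq_comm, ZMod.intCast_eq_intCast_iff_dvd_sub] at this
    rwa [hy, hy]
  · obtain ⟨m, rfl⟩ := exists_eq_multiples U
    refine (ofResidueSystem_eq_mk (residueSystems.proj_ofInt _ _ _)).trans (Eq.trans ?_ (hx _))
    rw [index_multiples, hy]

theorem ofResidueSystem_add (f g : residueSystems) :
    ofResidueSystem (f + g) = ofResidueSystem f + ofResidueSystem g := by
  refine Subtype.ext (funext fun U => ?_)
  obtain ⟨r, hr, hf⟩ := residueSystems.exists_proj_eq (index U) f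
  obtain ⟨s, hs, hg⟩ := residueSystems.exists_proj_eq (index U) g
  change _ = (ofResidueSystem f).1 U + (ofResidueSystem g).1 U
  rw [ofResidueSystem_eq_mk hf, ofResidueSystem_eq_mk hg,
    ofResidueSystem_eq_mk (r := (r : ℤ) + s) (by rw [map_add, hf, hg, Int.cast_add])]
  rfl

/-- The group of compatible systems of residues is the profinite completion of the integers. -/
noncomputable def equivResidueSystems : residueSystems ≃[addGroupLang] ZHat where
  toEquiv := Equiv.ofBijective ofResidueSystem
    ⟨ofResidueSystem_injective, ofResidueSystem_surjective⟩
  map_fun' := fun f x => by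
    let φ : residueSystems →+ ZHat := AddMonoidHom.mk' ofResidueSystem ofResidueSystem_add
    cases f with
    | zero => exact map_zero φ
    | neg => exact map_neg φ (x 0)
    | add => exact map_add φ (x 0) (x 1)
  map_rel' := fun r => r.elim

end ZHat

/-! ### Primitive recursive functions on the integers -/

namespace Primrec

/-- The encoding of ℤ sends n ≥ 0 to 2n and -(n + 1) to 2n + 1, so sign and absolute value are read
off from the parity and the half of the code. -/
theorem int_ofNat : Primrec (fun n : ℕ => (n : ℤ)) :=
  Primrec.encode_iff.1 <| Primrec.nat_double.of_eq fun _ => rfl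

theorem int_negSucc : Primrec Int.negSucc :=
  Primrec.encode_iff.1 <| Primrec.nat_double_succ.of_eq fun _ => rfl

theorem int_toNat : Primrec Int.toNat := by
  refine (Primrec.ite (c := fun z : ℤ => Encodable.encode z % 2 = 0)
    (Primrec.eq.comp (Primrec.nat_mod.comp Primrec.encode (Primrec.const 2)) (Primrec.const 0))
    (Primrec.nat_div.comp Primrec.encode (Primrec.const 2)) (Primrec.const 0)).of_eq fun z => ?_
  rcases z with n | n
  · change (if 2 * n % 2 = 0 then 2 * n / 2 else 0) = n
    rw [if_pos (by omega)]
    omega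
  · change (if (2 * n + 1) % 2 = 0 then (2 * n + 1) / 2 else 0) = 0
    rw [if_neg (by omega)]

theorem int_toNat_neg : Primrec fun z : ℤ => (-z).toNat := by
  refine (Primrec.ite (c := fun z : ℤ => Encodable.encode z % 2 = 0)
    (Primrec.eq.comp (Primrec.nat_mod.comp Primrec.encode (Primrec.const 2)) (Primrec.const 0))
    (Primrec.const 0) (Primrec.succ.comp
      (Primrec.nat_div.comp Primrec.encode (Primrec.const 2)))).of_eq fun z => ?_
  rcases z with n | n
  · change (if 2 * n % 2 = 0 then 0 else _) = _
    rw [if_pos (by omega)]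
    simp
  · change (if (2 * n + 1) % 2 = 0 then 0 else (2 * n + 1) / 2 + 1) = n + 1
    rw [if_neg (by omega)]
    omega

/-- Integer arithmetic is reduced to ℕ by writing every integer as the difference of its positive
and negative parts. -/
theorem int_subNatNat : Primrec₂ fun a b : ℕ => (a : ℤ) - b := by
  refine (Primrec.ite (c := fun p : ℕ × ℕ => p.2 ≤ p.1) (Primrec.nat_le.comp .snd .fst)
    (int_ofNat.comp (Primrec.nat_sub.comp .fst .snd))
    (int_negSucc.comp (Primrec.pred.comp (Primrec.nat_sub.comp .snd .fst)))).of_eq fun p => ?_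
  dsimp only
  split_ifs with h
  · omega
  · rw [Int.negSucc_eq, Nat.pred_eq_sub_one]
    omega

theorem int_neg : Primrec fun z : ℤ => -z :=
  (int_subNatNat.comp int_toNat_neg int_toNat).of_eq fun z => by omega

theorem int_add : Primrec₂ fun z w : ℤ => z + w :=
  (int_subNatNat.comp
    (nat_add.comp (int_toNat.comp fst) (int_toNat.comp snd))
    (nat_add.comp (int_toNat_neg.comp fst) (int_toNat_neg.comp snd))).of_eq fun p => by
      push_cast
      omega

theorem int_sub : Primrec₂ fun z w : ℤ => z - w :=
  (int_add.comp fst (int_neg.comp snd)).of_eq fun p => by ring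

theorem int_mul : Primrec₂ fun z w : ℤ => z * w :=
  (int_subNatNat.comp
    (nat_add.comp (nat_mul.comp (int_toNat.comp fst) (int_toNat.comp snd))
      (nat_mul.comp (int_toNat_neg.comp fst) (int_toNat_neg.comp snd)))
    (nat_add.comp (nat_mul.comp (int_toNat.comp fst) (int_toNat_neg.comp snd))
      (nat_mul.comp (int_toNat_neg.comp fst) (int_toNat.comp snd)))).of_eq fun p => by
      have h1 : p.1 = (p.1.toNat : ℤ) - (-p.1).toNat := by omega
      have h2 : p.2 = (p.2.toNat : ℤ) - (-p.2).toNat := by omega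
      conv_rhs => rw [h1, h2]
      push_cast
      ring

theorem int_natAbs : Primrec Int.natAbs :=
  (nat_add.comp int_toNat int_toNat_neg).of_eq fun z => by omega

theorem natCast_dvd_int : PrimrecRel fun (m : ℕ) (z : ℤ) => (m : ℤ) ∣ z :=
  (Primrec.eq.comp (nat_mod.comp (int_natAbs.comp snd) fst) (const 0)).of_eq fun p => by
    dsimp only
    rw [Int.natCast_dvd, Nat.dvd_iff_mod_eq_zero]

theorem nat_dvd : PrimrecRel fun m n : ℕ => m ∣ n :=
  (Primrec.eq.comp (nat_mod.comp snd fst) (const 0)).of_eq fun p => by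
    dsimp only
    rw [Nat.dvd_iff_mod_eq_zero]

theorem nat_pow : Primrec₂ fun a b : ℕ => a ^ b :=
  (nat_rec' snd (const 1) (nat_mul.comp (snd.comp snd) (fst.comp fst)).to₂).of_eq fun p => by
    dsimp only
    induction p.2 with
    | zero => rfl
    | succ n ih => rw [pow_succ, ← ih]

theorem nat_factorial : Primrec Nat.factorial :=
  (nat_rec₁ 1 (nat_mul.comp (succ.comp fst) snd).to₂).of_eq fun n => by
    induction n with
    | zero => rfl
    | succ n ih => rw [Nat.factorial_succ, ← ih]

theorem nat_pair : Primrec₂ Nat.pair := Primrec₂.natPair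

theorem list_all {α : Type*} [Primcodable α] {σ : Type*} [Primcodable σ] {f : α → List σ}
    {p : α → σ → Bool} (hf : Primrec f) (hp : Primrec₂ p) :
    Primrec fun a => (f a).all (p a) :=
  (list_foldr hf (const true)
    (Primrec.and.comp (hp.comp fst (fst.comp snd)) (snd.comp snd)).to₂).of_eq fun a => by
      dsimp only
      induction f a with
      | nil => rfl
      | cons b l ih => rw [List.foldr_cons, List.all_cons, ih]

end Primrec

/-! ### Evaluation of terms and formulas from their codes -/

theorem Nat.unpair_snd_lt {c : ℕ} (h : c.unpair.1 ≠ 0) : c.unpair.2 < c := by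
  have := Nat.add_le_pair c.unpair.1 c.unpair.2
  rw [Nat.pair_unpair] at this
  omega

/-- The value of the term with a given code in the integers. -/
def termVal (x : List ℤ) (c : ℕ) : ℤ :=
  if h0 : c.unpair.1 = 0 then x.getD c.unpair.2 0
  else if c.unpair.1 = 1 then 0
  else if c.unpair.1 = 2 then - termVal x c.unpair.2
  else termVal x c.unpair.2.unpair.1 + termVal x c.unpair.2.unpair.2
termination_by c
decreasing_by
  · exact Nat.unpair_snd_lt h0
  · exact (Nat.unpair_left_le _).trans_lt (Nat.unpair_snd_lt h0)
  · exact (Nat.unpair_right_le _).trans_lt (Nat.unpair_snd_lt h0)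

/-- This is a course-of-values recursion on the code, via `Primrec.nat_omega_rec'`: `l` lists the
smaller arguments whose values are needed and `g` combines those values. -/
theorem primrec_termVal : Primrec₂ termVal := by
  have hc : Primrec fun p : (List ℤ × ℕ) => p.2.unpair := Primrec.unpair.comp .snd
  have hc1 := Primrec.fst.comp hc
  have hc2 := Primrec.snd.comp hc
  have hc3 := Primrec.unpair.comp hc2
  -- For every nonzero tag all three possible subterms are listed. Position 0 serves negation,
  -- positions 1 and 2 serve addition.
  let l : List ℤ × ℕ → List (List ℤ × ℕ) := fun p =>
    if p.2.unpair.1 = 0 then [] else [(p.1, p.2.unpair.2), (p.1, p.2.unpair.2.unpair.1),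
      (p.1, p.2.unpair.2.unpair.2)]
  have hl : Primrec l := Primrec.ite (Primrec.eq.comp hc1 (.const 0)) (.const [])
    (Primrec.list_cons.comp (Primrec.fst.pair hc2) (Primrec.list_cons.comp
      (Primrec.fst.pair (Primrec.fst.comp hc3)) (Primrec.list_cons.comp
      (Primrec.fst.pair (Primrec.snd.comp hc3)) (.const []))))
  let g : List ℤ × ℕ → List ℤ → Option ℤ := fun p vs => some <|
    if p.2.unpair.1 = 0 then p.1.getD p.2.unpair.2 0
    else if p.2.unpair.1 = 1 then 0
    else if p.2.unpair.1 = 2 then - vs.getD 0 0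
    else vs.getD 1 0 + vs.getD 2 0
  have hg : Primrec₂ g := by
    have hv : ∀ i : ℕ, Primrec fun q : (List ℤ × ℕ) × List ℤ => q.2.getD i 0 := fun i =>
      (Primrec.list_getD 0).comp .snd (.const i)
    have ht : Primrec fun q : (List ℤ × ℕ) × List ℤ => q.1.2.unpair.1 := hc1.comp .fst
    exact Primrec.option_some.comp <|
      Primrec.ite (Primrec.eq.comp ht (.const 0))
        ((Primrec.list_getD 0).comp (Primrec.fst.comp .fst) (hc2.comp .fst)) <|
      Primrec.ite (Primrec.eq.comp ht (.const 1)) (.const 0) <|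
      Primrec.ite (Primrec.eq.comp ht (.const 2)) (Primrec.int_neg.comp (hv 0))
        (Primrec.int_add.comp (hv 1) (hv 2))
  refine Primrec.nat_omega_rec' (fun p : List ℤ × ℕ => termVal p.1 p.2) Primrec.snd hl hg ?_ ?_
  · rintro ⟨x, c⟩ b hb
    by_cases h : c.unpair.1 = 0
    · simp [l, h] at hb
    · simp only [l, h, if_false, List.mem_cons, List.not_mem_nil, or_false] at hb
      have := Nat.unpair_snd_lt h
      have h1 := Nat.unpair_left_le c.unpair.2
      have h2 := Nat.unpair_right_le c.unpair.2
      rcases hb with rfl | rfl | rfl <;> dsimp only <;> omega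
  · rintro ⟨x, c⟩
    by_cases h : c.unpair.1 = 0
    · simp only [g, l]
      rw [termVal]
      simp [h]
    · simp only [g, l]
      rw [termVal]
      simp [h]

/-- The integers of absolute value at most `K`. -/
def intsUpTo (K : ℕ) : List ℤ := (List.range (2 * K + 1)).map fun i : ℕ => (i : ℤ) - K

theorem mem_intsUpTo {K : ℕ} {z : ℤ} : z ∈ intsUpTo K ↔ z.natAbs ≤ K := by
  simp only [intsUpTo, List.mem_map, List.mem_range]
  constructor
  · rintro ⟨i, hi, rfl⟩
    omega
  · intro h
    exact ⟨(z + K).toNat, by omega, by omega⟩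

theorem primrec_intsUpTo : Primrec intsUpTo :=
  Primrec.list_map (Primrec.list_range.comp (Primrec.succ.comp Primrec.nat_double))
    (Primrec.int_subNatNat.comp .snd .fst).to₂

/-- The range of the bounded quantifiers in the evaluation of formulas over the integers. -/
def quantBound (B : ℕ) (x : List ℤ) : ℕ := B * (1 + (x.map Int.natAbs).sum)

theorem primrec_quantBound : Primrec₂ quantBound := by
  have : Primrec fun x : List ℤ => (x.map Int.natAbs).sum :=
    (Primrec.list_foldr Primrec.id (.const 0) (Primrec.nat_add.comp
      (Primrec.int_natAbs.comp (Primrec.fst.comp .snd)) (Primrec.snd.comp .snd)).to₂).of_eq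
      fun x => by
        dsimp only [id]
        induction x with
        | nil => rfl
        | cons z x ih => rw [List.foldr_cons, List.map_cons, List.sum_cons, ih]
  exact Primrec.nat_mul.comp .fst (Primrec.nat_add.comp (.const 1) (this.comp .snd))

/-- The evaluation of the formula with a given code in the integers, where the range of the
quantifiers is bounded. -/
def formulaVal (B : ℕ) (x : List ℤ) (c : ℕ) : Bool :=
  if h0 : c.unpair.1 = 0 then false
  else if c.unpair.1 = 1 then decide (termVal x c.unpair.2.unpair.1 = termVal x c.unpair.2.unpair.2)
  else if c.unpair.1 = 2 then
    !formulaVal B x c.unpair.2.unpair.1 || formulaVal B x c.unpair.2.unpair.2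
  else (intsUpTo (quantBound B x)).all fun z => formulaVal B (x ++ [z]) c.unpair.2
termination_by c
decreasing_by
  · exact (Nat.unpair_left_le _).trans_lt (Nat.unpair_snd_lt h0)
  · exact (Nat.unpair_right_le _).trans_lt (Nat.unpair_snd_lt h0)
  · exact Nat.unpair_snd_lt h0

/-- A quantifier calls the recursion on longer lists of values. This is harmless, since only the
code has to decrease. -/
theorem primrec_formulaVal : Primrec fun p : (ℕ × List ℤ) × ℕ => formulaVal p.1.1 p.1.2 p.2 := by
  have hc : Primrec fun p : (ℕ × List ℤ) × ℕ => p.2.unpair := Primrec.unpair.comp .snd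
  have hc1 := Primrec.fst.comp hc
  have hc2 := Primrec.snd.comp hc
  have hc3 := Primrec.unpair.comp hc2
  have hx : Primrec fun p : (ℕ × List ℤ) × ℕ => p.1.2 := Primrec.snd.comp .fst
  have hB : Primrec fun p : (ℕ × List ℤ) × ℕ => p.1.1 := Primrec.fst.comp .fst
  let l : (ℕ × List ℤ) × ℕ → List ((ℕ × List ℤ) × ℕ) := fun p =>
    if p.2.unpair.1 = 0 then []
    else if p.2.unpair.1 = 1 then []
    else if p.2.unpair.1 = 2 then
      [(p.1, p.2.unpair.2.unpair.1), (p.1, p.2.unpair.2.unpair.2)]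
    else (intsUpTo (quantBound p.1.1 p.1.2)).map fun z => ((p.1.1, p.1.2 ++ [z]), p.2.unpair.2)
  have hl : Primrec l :=
    Primrec.ite (Primrec.eq.comp hc1 (.const 0)) (.const []) <|
    Primrec.ite (Primrec.eq.comp hc1 (.const 1)) (.const []) <|
    Primrec.ite (Primrec.eq.comp hc1 (.const 2))
      (Primrec.list_cons.comp (Primrec.fst.pair (Primrec.fst.comp hc3)) (Primrec.list_cons.comp
        (Primrec.fst.pair (Primrec.snd.comp hc3)) (.const []))) <|
      Primrec.list_map (primrec_intsUpTo.comp (primrec_quantBound.comp hB hx))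
        (((hB.comp .fst).pair (Primrec.list_concat.comp (hx.comp .fst) .snd)).pair
          (hc2.comp .fst)).to₂
  let g : (ℕ × List ℤ) × ℕ → List Bool → Option Bool := fun p vs => some <|
    if p.2.unpair.1 = 0 then false
    else if p.2.unpair.1 = 1 then
      decide (termVal p.1.2 p.2.unpair.2.unpair.1 = termVal p.1.2 p.2.unpair.2.unpair.2)
    else if p.2.unpair.1 = 2 then !vs.getD 0 false || vs.getD 1 false
    else vs.all id
  have hg : Primrec₂ g := by
    have hv : ∀ i : ℕ, Primrec fun q : ((ℕ × List ℤ) × ℕ) × List Bool => q.2.getD i false :=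
      fun i => (Primrec.list_getD false).comp .snd (.const i)
    have ht : Primrec fun q : ((ℕ × List ℤ) × ℕ) × List Bool => q.1.2.unpair.1 := hc1.comp .fst
    refine Primrec.option_some.comp <|
      Primrec.ite (Primrec.eq.comp ht (.const 0)) (.const false) <|
      Primrec.ite (Primrec.eq.comp ht (.const 1)) ?_ <|
      Primrec.ite (Primrec.eq.comp ht (.const 2))
        (Primrec.or.comp (Primrec.not.comp (hv 0)) (hv 1))
        (Primrec.list_all .snd Primrec.snd.to₂)
    exact (Primrec.eq.comp
      (primrec_termVal.comp (hx.comp .fst) ((Primrec.fst.comp hc3).comp .fst))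
      (primrec_termVal.comp (hx.comp .fst) ((Primrec.snd.comp hc3).comp .fst))).decide
  refine Primrec.nat_omega_rec' (fun p : (ℕ × List ℤ) × ℕ => formulaVal p.1.1 p.1.2 p.2)
    Primrec.snd hl hg ?_ ?_
  · rintro ⟨⟨B, x⟩, c⟩ b hb
    simp only [l] at hb
    split_ifs at hb with h0 h1 h2
    · simp at hb
    · simp at hb
    · simp only [List.mem_cons, List.not_mem_nil, or_false] at hb
      have := Nat.unpair_snd_lt h0
      have h1 := Nat.unpair_left_le c.unpair.2
      have h2 := Nat.unpair_right_le c.unpair.2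
      rcases hb with rfl | rfl <;> dsimp only <;> omega
    · obtain ⟨z, -, rfl⟩ := List.mem_map.1 hb
      exact Nat.unpair_snd_lt h0
  · rintro ⟨⟨B, x⟩, c⟩
    simp only [g, l]
    rw [formulaVal]
    split_ifs <;> simp [Function.comp_def]

/-! ### Terms as linear forms -/

section Unfold

variable (B : ℕ) (x : List ℤ) (a b : ℕ)

theorem termVal_var : termVal x (Nat.pair 0 a) = x.getD a 0 := by
  rw [termVal]; simp

theorem termVal_zero : termVal x (Nat.pair 1 a) = 0 := by
  rw [termVal]; simp

theorem termVal_neg : termVal x (Nat.pair 2 a) = - termVal x a := by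
  rw [termVal]; simp

theorem termVal_add :
    termVal x (Nat.pair 3 (Nat.pair a b)) = termVal x a + termVal x b := by
  rw [termVal]; simp

theorem formulaVal_falsum : formulaVal B x (Nat.pair 0 a) = false := by
  rw [formulaVal]; simp

theorem formulaVal_equal :
    formulaVal B x (Nat.pair 1 (Nat.pair a b)) = true ↔ termVal x a = termVal x b := by
  rw [formulaVal]; simp

theorem formulaVal_imp : formulaVal B x (Nat.pair 2 (Nat.pair a b)) = true ↔
    (formulaVal B x a = true → formulaVal B x b = true) := by
  rw [formulaVal]
  simp only [Nat.unpair_pair]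
  cases formulaVal B x a <;> simp

theorem formulaVal_all : formulaVal B x (Nat.pair 3 a) = true ↔
    ∀ z : ℤ, z.natAbs ≤ quantBound B x → formulaVal B (x ++ [z]) a = true := by
  rw [formulaVal]
  simp [mem_intsUpTo]

end Unfold

/-- Relations compatible with the operations are preserved by terms. -/
theorem termVal_rel {α : Type} (v : α → ℕ) {S : ℤ → residueSystems → Prop} (h0 : S 0 0)
    (hneg : ∀ z f, S z f → S (-z) (-f)) (hadd : ∀ z f w g, S z f → S w g → S (z + w) (f + g))
    {x : List ℤ} {X : α → residueSystems} (hX : ∀ b, S (x.getD (v b) 0) (X b))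
    (t : addGroupLang.Term α) : S (termVal x (termCode v t)) (t.realize X) := by
  induction t with
  | var b =>
    rw [termCode, termVal_var]
    exact hX b
  | func f ts ih =>
    cases f with
    | zero =>
      rw [termCode, termVal_zero]
      exact h0
    | neg =>
      rw [termCode, termVal_neg]
      exact hneg _ _ (ih 0)
    | add =>
      rw [termCode, termVal_add]
      exact hadd _ _ _ _ (ih 0) (ih 1)

/-- The same coefficients serve in ℤ and in R, which is what links both evaluations. The bound holds
because codes grow at least as fast as coefficients. The summand 1 is needed for the variable with
code 0. -/
theorem exists_linear_form {α : Type} (v : α → ℕ) (t : addGroupLang.Term α) :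
    ∃ a : ℕ → ℤ, (∀ i, (a i).natAbs ≤ termCode v t + 1) ∧ ∀ m, (∀ b, v b < m) →
      (∀ x : List ℤ, termVal x (termCode v t) = ∑ i ∈ Finset.range m, a i * x.getD i 0) ∧
      ∀ X : ℕ → residueSystems,
        t.realize (fun b => X (v b)) = ∑ i ∈ Finset.range m, a i • X i := by
  induction t with
  | var b =>
    refine ⟨Pi.single (v b) 1, fun i => ?_, fun m hm => ⟨fun x => ?_, fun X => ?_⟩⟩
    · by_cases h : i = v b
      · subst h
        simp
      · simp [Pi.single_eq_of_ne h]
    · rw [termCode, termVal_var, Finset.sum_eq_single (v b)]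
      · simp
      · intro i _ hi
        simp [Pi.single_eq_of_ne hi]
      · exact fun h => absurd (Finset.mem_range.2 (hm b)) h
    · rw [Finset.sum_eq_single (v b)]
      · simp
      · intro i _ hi
        simp [Pi.single_eq_of_ne hi]
      · exact fun h => absurd (Finset.mem_range.2 (hm b)) h
  | func f ts ih =>
    cases f with
    | zero =>
      refine ⟨0, fun i => by simp, fun m _ => ⟨fun x => ?_, fun X => ?_⟩⟩
      · rw [termCode, termVal_zero]
        simp
      · simp only [Pi.zero_apply, zero_smul, Finset.sum_const_zero]
        rfl
    | neg =>
      obtain ⟨a, ha, h⟩ := ih 0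
      refine ⟨-a, fun i => ?_, fun m hm => ⟨fun x => ?_, fun X => ?_⟩⟩
      · have h1 := ha i
        have h2 := Nat.add_le_pair 2 (termCode v (ts 0))
        rw [termCode, Pi.neg_apply, Int.natAbs_neg]
        omega
      · rw [termCode, termVal_neg, (h m hm).1]
        simp
      · simp only [Pi.neg_apply, neg_smul, Finset.sum_neg_distrib]
        rw [← (h m hm).2]
        rfl
    | add =>
      obtain ⟨a, ha, h⟩ := ih 0
      obtain ⟨b, hb, h'⟩ := ih 1
      refine ⟨a + b, fun i => ?_, fun m hm => ⟨fun x => ?_, fun X => ?_⟩⟩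
      · have h1 := ha i
        have h2 := hb i
        have h3 := Nat.add_le_pair (termCode v (ts 0)) (termCode v (ts 1))
        have h4 := Nat.add_le_pair 3 (Nat.pair (termCode v (ts 0)) (termCode v (ts 1)))
        rw [termCode, Pi.add_apply]
        omega
      · rw [termCode, termVal_add, (h m hm).1, (h' m hm).1]
        simp [add_mul, Finset.sum_add_distrib]
      · simp only [Pi.add_apply, add_smul, Finset.sum_add_distrib]
        rw [← (h m hm).2, ← (h' m hm).2]
        rfl

/-! ### Elementary equivalence up to a level -/

namespace residueSystems

open Finset

instance (N : ℕ) : NeZero N.factorial := ⟨N.factorial_ne_zero⟩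

/-- Two tuples of length `m` have the same residues modulo `N!` and satisfy the same linear
equations with coefficients bounded by `N`. -/
structure Similar (N m : ℕ) (X X' : ℕ → residueSystems) : Prop where
  residue : ∀ i < m, proj N.factorial (X i) = proj N.factorial (X' i)
  relation : ∀ a : ℕ → ℤ, (∀ i, (a i).natAbs ≤ N) →
    (∑ i ∈ range m, a i • X i = 0 ↔ ∑ i ∈ range m, a i • X' i = 0)

/-- Here c·N! divides N!·N!, which divides (2N)!. So agreement modulo (2N²)! still gives agreement
modulo N! after division by c. -/
theorem mul_factorial_dvd {N : ℕ} {c : ℕ} (hc : c ≠ 0) (hN : c ≤ N) :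
    c * N.factorial ∣ (2 * N ^ 2).factorial := by
  have h1 : c ∣ N.factorial := Nat.dvd_factorial (Nat.pos_of_ne_zero hc) hN
  refine (Nat.mul_dvd_mul_right h1 _).trans
    ((Nat.factorial_mul_factorial_dvd_factorial_add N N).trans (Nat.factorial_dvd_factorial ?_))
  nlinarith

theorem proj_sum_eq {k m : ℕ} [NeZero k] {X X' : ℕ → residueSystems} {a : ℕ → ℤ}
    (h : ∀ i < m, proj k (X i) = proj k (X' i)) :
    proj k (∑ i ∈ range m, a i • X i) = proj k (∑ i ∈ range m, a i • X' i) := by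
  rw [map_sum, map_sum]
  refine sum_congr rfl fun i hi => ?_
  rw [map_zsmul, map_zsmul, h i (mem_range.1 hi)]

theorem proj_eq_of_dvd {m k : ℕ} [NeZero m] [NeZero k] (h : m ∣ k) {f g : residueSystems}
    (hf : proj k f = proj k g) : proj m f = proj m g := by
  rw [← castHom_proj h, hf, castHom_proj h]

/-- A dependent entry Y is eliminated from a relation by multiplying with c; the coefficients become
quadratic in the old ones. -/
theorem zsmul_linear_comb {m : ℕ} {X : ℕ → residueSystems} {u v : ℕ → ℤ} {c d : ℤ}
    {Y : residueSystems} (h : c • Y = ∑ i ∈ range m, v i • X i) :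
    c • (∑ i ∈ range m, u i • X i + d • Y) = ∑ i ∈ range m, (c * u i + d * v i) • X i := by
  rw [smul_add, smul_comm c d Y, h, smul_sum, smul_sum, ← sum_add_distrib]
  refine sum_congr rfl fun i _ => ?_
  rw [add_smul, mul_smul, mul_smul]

/-- An element can be added to the first of two similar tuples if an element with prescribed
residues and without relations can be added to the second one. -/
theorem Similar.exists_extend {N m : ℕ} {X X' : ℕ → residueSystems}
    (h : Similar (2 * N ^ 2) m X X') (Y : residueSystems) {P : residueSystems → Prop}
    (hgen : ∃ Y', P Y' ∧ proj N.factorial Y' = proj N.factorial Y ∧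
      ∀ a : ℕ → ℤ, (∀ i, (a i).natAbs ≤ N) → ∀ d : ℤ, d ≠ 0 → d.natAbs ≤ N →
        ∑ i ∈ range m, a i • X' i + d • Y' ≠ 0)
    (hP : ∀ a : ℕ → ℤ, (∀ i, (a i).natAbs ≤ N) → ∀ c : ℤ, c ≠ 0 → ∀ Y',
      c • Y' = ∑ i ∈ range m, a i • X' i → P Y') :
    ∃ Y', P Y' ∧ proj N.factorial Y' = proj N.factorial Y ∧
      ∀ a : ℕ → ℤ, (∀ i, (a i).natAbs ≤ N) → ∀ d : ℤ, d.natAbs ≤ N →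
        (∑ i ∈ range m, a i • X i + d • Y = 0 ↔ ∑ i ∈ range m, a i • X' i + d • Y' = 0) := by
  -- The dichotomy is whether `Y` depends on the old entries with coefficients at most `N`, or is
  -- generic.
  by_cases hA : ∃ v : ℕ → ℤ, (∀ i, (v i).natAbs ≤ N) ∧ ∃ c : ℤ, c ≠ 0 ∧ c.natAbs ≤ N ∧
      c • Y = ∑ i ∈ range m, v i • X i
  · obtain ⟨v, hv, c, hc, hcN, hY⟩ := hA
    have hc' : c.natAbs ≠ 0 := Int.natAbs_ne_zero.2 hc
    have : NeZero c.natAbs := ⟨hc'⟩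
    have : NeZero (c.natAbs * N.factorial) := ⟨mul_ne_zero hc' (NeZero.ne _)⟩
    have hdvd := mul_factorial_dvd hc' hcN
    have hres : proj (c.natAbs * N.factorial) (∑ i ∈ range m, v i • X' i) =
        proj (c.natAbs * N.factorial) (c • Y) := by
      rw [hY]
      exact (proj_sum_eq fun i hi => proj_eq_of_dvd hdvd (h.residue i hi)).symm
    -- The transported right side is congruent to `c • Y` modulo |c|·N!, hence vanishes modulo |c|
    -- and can be divided by `c`.
    obtain ⟨Y', hY'⟩ := exists_zsmul_eq (c := c) (f := ∑ i ∈ range m, v i • X' i) (by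
      rw [proj_eq_of_dvd (dvd_mul_right _ _) hres, map_zsmul, zsmul_eq_mul,
        (ZMod.intCast_zmod_eq_zero_iff_dvd c c.natAbs).2 (Int.natAbs_dvd.2 dvd_rfl), zero_mul])
    refine ⟨Y', hP v hv c hc Y' hY', ?_, fun u hu d hd => ?_⟩
    · rw [← sub_eq_zero, ← map_sub]
      refine proj_eq_zero_of_zsmul (c := c) ?_
      rw [zsmul_sub, map_sub, hY', hres, sub_self]
    -- After eliminating `Y` the coefficients have size at most N² + N². This is why similarity is
    -- assumed at level 2N².
    · have hN : ∀ i, (c * u i + d * v i).natAbs ≤ 2 * N ^ 2 := fun i => by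
        refine (Int.natAbs_add_le _ _).trans ?_
        rw [Int.natAbs_mul, Int.natAbs_mul]
        have h1 := Nat.mul_le_mul hcN (hu i)
        have h2 := Nat.mul_le_mul hd (hv i)
        nlinarith
      have key := h.relation _ hN
      rw [← zsmul_linear_comb hY, ← zsmul_linear_comb hY'] at key
      have hz : ∀ f : residueSystems, c • f = 0 ↔ f = 0 := fun f =>
        ⟨eq_zero_of_zsmul_eq_zero hc, fun h => by rw [h, smul_zero]⟩
      rwa [hz, hz] at key
  · obtain ⟨Y', hPY, hres, hrel⟩ := hgen
    refine ⟨Y', hPY, hres, fun u hu d hd => ?_⟩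
    rcases eq_or_ne d 0 with rfl | hd0
    · simp only [zero_smul, add_zero]
      exact h.relation u fun i => (hu i).trans (by nlinarith [Nat.zero_le N])
    -- A relation involving `Y` with `d ≠ 0` would itself be a dependence excluded by `hA`.
    · refine iff_of_false (fun h0 => hA ⟨-u, fun i => ?_, d, hd0, hd, ?_⟩) (hrel u hu d hd0 hd)
      · rw [Pi.neg_apply, Int.natAbs_neg]
        exact hu i
      · simp only [Pi.neg_apply, neg_smul, sum_neg_distrib]
        exact (neg_eq_of_add_eq_zero_right h0).symm

theorem Similar.update {N m : ℕ} {X X' : ℕ → residueSystems} {Y Y' : residueSystems}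
    (h : ∀ i < m, proj N.factorial (X i) = proj N.factorial (X' i))
    (hY : proj N.factorial Y' = proj N.factorial Y)
    (hr : ∀ a : ℕ → ℤ, (∀ i, (a i).natAbs ≤ N) → ∀ d : ℤ, d.natAbs ≤ N →
      (∑ i ∈ range m, a i • X i + d • Y = 0 ↔ ∑ i ∈ range m, a i • X' i + d • Y' = 0)) :
    Similar N (m + 1) (Function.update X m Y) (Function.update X' m Y') := by
  have key : ∀ (a : ℕ → ℤ) (X : ℕ → residueSystems) (Y : residueSystems),
      ∑ i ∈ range (m + 1), a i • Function.update X m Y i =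
        ∑ i ∈ range m, a i • X i + a m • Y := fun a X Y => by
    rw [sum_range_succ, Function.update_self]
    congr 1
    refine sum_congr rfl fun i hi => ?_
    rw [Function.update_of_ne (mem_range.1 hi).ne]
  refine ⟨fun i hi => ?_, fun a ha => ?_⟩
  · rcases (Nat.lt_succ_iff.1 hi).lt_or_eq with hi | rfl
    · rw [Function.update_of_ne hi.ne, Function.update_of_ne hi.ne, h i hi]
    · rw [Function.update_self, Function.update_self, hY]
  · rw [key, key]
    exact hr a ha (a m) (ha m)

theorem finite_linear_combs (N m : ℕ) (X : ℕ → residueSystems) :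
    {f | ∃ a : ℕ → ℤ, (∀ i, (a i).natAbs ≤ N) ∧ f = ∑ i ∈ range m, a i • X i}.Finite := by
  induction m with
  | zero => exact (Set.finite_singleton 0).subset fun f ⟨a, _, hf⟩ => by simpa using hf
  | succ m ih =>
    refine (Set.Finite.image2 (fun f (z : ℤ) => f + z • X m) ih
      (Set.finite_Icc (-(N : ℤ)) N)).subset ?_
    rintro _ ⟨a, ha, rfl⟩
    refine ⟨_, ⟨a, ha, rfl⟩, a m, ?_, (sum_range_succ _ _).symm⟩
    have := ha m
    exact ⟨by omega, by omega⟩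

/-- The residue class of y modulo N! contains infinitely many integers. By torsion-freeness each of
the finitely many bounded relations excludes at most one element. -/
theorem exists_generic (N m : ℕ) (X : ℕ → residueSystems) (y : ℤ) :
    ∃ Y, proj N.factorial Y = y ∧
      ∀ a : ℕ → ℤ, (∀ i, (a i).natAbs ≤ N) → ∀ d : ℤ, d ≠ 0 → d.natAbs ≤ N →
        ∑ i ∈ range m, a i • X i + d • Y ≠ 0 := by
  have hbad : {Y | ∃ a : ℕ → ℤ, (∀ i, (a i).natAbs ≤ N) ∧ ∃ d : ℤ, d ≠ 0 ∧ d.natAbs ≤ N ∧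
      ∑ i ∈ range m, a i • X i + d • Y = 0}.Finite := by
    refine ((Set.finite_Icc (-(N : ℤ)) N).biUnion fun d _ =>
      (finite_linear_combs N m X).biUnion fun f _ =>
        (Set.Subsingleton.finite (s := {Y | d ≠ 0 ∧ f + d • Y = 0}) ?_)).subset ?_
    · rintro Y ⟨hd, hY⟩ Z ⟨-, hZ⟩
      exact zsmul_injective hd (add_left_cancel (hY.trans hZ.symm))
    · rintro Y ⟨a, ha, d, hd0, hd, hY⟩
      simp only [Set.mem_iUnion]
      exact ⟨d, ⟨by omega, by omega⟩, _, ⟨a, ha, rfl⟩, hd0, hY⟩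
  have hinj : Function.Injective fun t : ℕ => int (y + N.factorial * t) := fun s t hst => by
    have h1 := int_injective hst
    have h2 : (N.factorial : ℤ) ≠ 0 := by exact_mod_cast N.factorial_ne_zero
    exact_mod_cast mul_left_cancel₀ h2 (add_left_cancel h1)
  obtain ⟨Y, ⟨t, rfl⟩, hY⟩ := (Set.infinite_range_of_injective hinj).exists_notMem_finite hbad
  refine ⟨_, ?_, fun a ha d hd0 hd h0 => hY ⟨a, ha, d, hd0, hd, h0⟩⟩
  rw [proj_int]
  push_cast
  simp

end residueSystems

/-! ### Back-and-forth between compatible systems and the integers, with bounds -/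

namespace residueSystems

open Finset

theorem Similar.symm {N m : ℕ} {X X' : ℕ → residueSystems} (h : Similar N m X X') :
    Similar N m X' X :=
  ⟨fun i hi => (h.residue i hi).symm, fun a ha => (h.relation a ha).symm⟩

theorem Similar.residue_of_sq {N m : ℕ} {X X' : ℕ → residueSystems}
    (h : Similar (2 * N ^ 2) m X X') (i : ℕ) (hi : i < m) :
    proj N.factorial (X i) = proj N.factorial (X' i) :=
  proj_eq_of_dvd (Nat.factorial_dvd_factorial (by nlinarith [Nat.zero_le N])) (h.residue i hi)

/-- The constant systems given by the entries of a list. -/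
def ints (x : List ℤ) (i : ℕ) : residueSystems := int (x.getD i 0)

theorem ints_concat (x : List ℤ) (y : ℤ) :
    ints (x ++ [y]) = Function.update (ints x) x.length (int y) := by
  funext i
  rcases lt_trichotomy i x.length with h | rfl | h
  · rw [Function.update_of_ne h.ne, ints, ints, List.getD_append _ _ _ _ h]
  · rw [Function.update_self, ints]
    simp
  · rw [Function.update_of_ne h.ne', ints, ints, List.getD_eq_default _ _ (by simpa using h),
      List.getD_eq_default _ _ h.le]

theorem sum_ints (x : List ℤ) (a : ℕ → ℤ) (m : ℕ) :
    ∑ i ∈ range m, a i • ints x i = int (∑ i ∈ range m, a i * x.getD i 0) := by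
  rw [map_sum]
  exact sum_congr rfl fun i _ => zsmul_int _ _

theorem _root_.List.sum_map_natAbs (x : List ℤ) :
    (x.map Int.natAbs).sum = ∑ i ∈ range x.length, (x.getD i 0).natAbs := by
  induction x with
  | nil => rfl
  | cons z x ih =>
    rw [List.map_cons, List.sum_cons, ih, List.length_cons, sum_range_succ', add_comm]
    simp

theorem natAbs_linear_form_le {N : ℕ} (x : List ℤ) {a : ℕ → ℤ} (ha : ∀ i, (a i).natAbs ≤ N) :
    (∑ i ∈ range x.length, a i * x.getD i 0).natAbs ≤ N * (x.map Int.natAbs).sum := by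
  rw [List.sum_map_natAbs, mul_sum]
  refine (Int.natAbs_sum_le _ _).trans (sum_le_sum fun i _ => ?_)
  rw [Int.natAbs_mul]
  exact Nat.mul_le_mul_right _ (ha i)

/-- The explicit bound is what allows quantifiers over ℤ to be bounded. A dependent match is a
quotient of a linear form in `x`, hence small; a generic match only has to exceed every such linear
form. -/
theorem Similar.exists_int {N : ℕ} {x : List ℤ} {X : ℕ → residueSystems}
    (h : Similar (2 * N ^ 2) x.length X (ints x)) (Y : residueSystems) :
    ∃ y : ℤ, y.natAbs ≤ N.factorial * (N * (x.map Int.natAbs).sum + 2) ∧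
      Similar N (x.length + 1) (Function.update X x.length Y) (ints (x ++ [y])) := by
  set S := N * (x.map Int.natAbs).sum with hS
  have hpos := N.factorial_pos
  have hgen : ∃ Y', (∃ y : ℤ, y.natAbs ≤ N.factorial * (S + 2) ∧ Y' = int y) ∧
      proj N.factorial Y' = proj N.factorial Y ∧
      ∀ a : ℕ → ℤ, (∀ i, (a i).natAbs ≤ N) → ∀ d : ℤ, d ≠ 0 → d.natAbs ≤ N →
        ∑ i ∈ range x.length, a i • ints x i + d • Y' ≠ 0 := by
    obtain ⟨r, hr, hY⟩ := exists_proj_eq N.factorial Y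
    -- This integer has the residue of `Y` and exceeds `S`, which bounds all linear forms in `x`
    -- with coefficients at most `N`. So no nonzero multiple of it can cancel one.
    refine ⟨_, ⟨(r : ℤ) + N.factorial * (S + 1 : ℕ), ?_, rfl⟩, ?_, fun a ha d hd0 hd h0 => ?_⟩
    · have : N.factorial * (S + 2) = N.factorial * (S + 1) + N.factorial := by ring
      have h2 : ((r : ℤ) + N.factorial * (S + 1 : ℕ)).natAbs = r + N.factorial * (S + 1) := by
        rw [← Nat.cast_mul, ← Nat.cast_add, Int.natAbs_natCast]
      omega
    · rw [hY, proj_int]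
      push_cast
      simp
    · rw [sum_ints, zsmul_int, ← map_add, int_eq_zero] at h0
      have h1 := natAbs_linear_form_le x ha
      have h2 : (d * ((r : ℤ) + N.factorial * (S + 1 : ℕ))).natAbs ≤ S := by
        rw [← neg_eq_of_add_eq_zero_right h0, Int.natAbs_neg]
        exact h1
      rw [Int.natAbs_mul, ← Nat.cast_mul, ← Nat.cast_add, Int.natAbs_natCast] at h2
      have h3 := Nat.le_mul_of_pos_left (r + N.factorial * (S + 1)) (Int.natAbs_pos.2 hd0)
      have h4 := Nat.le_mul_of_pos_left (S + 1) hpos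
      omega
  obtain ⟨_, ⟨y, hy, rfl⟩, hres, hrel⟩ := h.exists_extend Y hgen fun a ha c hc Y' hY' => by
    rw [sum_ints] at hY'
    have hc' : c.natAbs ≠ 0 := Int.natAbs_ne_zero.2 hc
    have : NeZero c.natAbs := ⟨hc'⟩
    -- Divisibility by `c` in R implies divisibility in ℤ, seen in the residue modulo |c|. So `Y'`
    -- is itself an integer.
    have hd : c ∣ ∑ i ∈ range x.length, a i * x.getD i 0 := by
      have := congrArg (proj c.natAbs) hY'
      rw [map_zsmul, proj_int, zsmul_eq_mul,
        (ZMod.intCast_zmod_eq_zero_iff_dvd c c.natAbs).2 (Int.natAbs_dvd.2 dvd_rfl), zero_mul,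
        eq_comm, ZMod.intCast_zmod_eq_zero_iff_dvd] at this
      exact Int.natAbs_dvd.1 this
    obtain ⟨y, hy⟩ := hd
    refine ⟨y, ?_, zsmul_injective hc (by rw [hY', hy, zsmul_int])⟩
    have h1 := natAbs_linear_form_le x ha
    rw [hy, Int.natAbs_mul] at h1
    have h2 := Nat.le_mul_of_pos_left y.natAbs (Nat.pos_of_ne_zero hc')
    have h3 := Nat.le_mul_of_pos_left (S + 2) hpos
    omega
  refine ⟨y, hy, ?_⟩
  rw [ints_concat]
  exact Similar.update h.residue_of_sq hres hrel

/-- The other direction of the back-and-forth needs no bound, so the generic case is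
`exists_generic`. -/
theorem Similar.exists_residueSystem {N : ℕ} {x : List ℤ} {X : ℕ → residueSystems}
    (h : Similar (2 * N ^ 2) x.length X (ints x)) (y : ℤ) :
    ∃ Y, Similar N (x.length + 1) (Function.update X x.length Y) (ints (x ++ [y])) := by
  obtain ⟨Y', hY, hgen⟩ := exists_generic N x.length X y
  obtain ⟨Y, -, hres, hrel⟩ := h.symm.exists_extend (int y) (P := fun _ => True)
    ⟨Y', trivial, by rw [hY, proj_int], hgen⟩ fun _ _ _ _ _ _ => trivial
  refine ⟨Y, ?_⟩
  rw [ints_concat]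
  exact (Similar.update h.symm.residue_of_sq hres hrel).symm

/-- Entries are matched one at a time, with the level squared and doubled in advance for each entry
still to come. -/
theorem exists_similar_ints (N m : ℕ) (X : ℕ → residueSystems) :
    ∃ x : List ℤ, x.length = m ∧ Similar N m X (ints x) := by
  induction m generalizing N with
  | zero => exact ⟨[], rfl, fun i hi => absurd hi (Nat.not_lt_zero i), fun a _ => by simp⟩
  | succ m ih =>
    obtain ⟨x, rfl, hx⟩ := ih (2 * N ^ 2)
    obtain ⟨y, -, hy⟩ := hx.exists_int (X x.length)
    refine ⟨x ++ [y], by simp, ?_⟩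
    rwa [Function.update_eq_self] at hy

/-- The level of similarity that is needed for `d` nested quantifiers. -/
def level (N d : ℕ) : ℕ := (fun k => 2 * k ^ 2)^[d] N

theorem level_succ (N d : ℕ) : level N (d + 1) = 2 * level N d ^ 2 :=
  Function.iterate_succ_apply' _ _ _

theorem level_mono (N : ℕ) : Monotone (level N) :=
  monotone_nat_of_le_succ fun d => by
    rw [level_succ]
    nlinarith [Nat.zero_le (level N d)]

/-- A bound for the quantifiers that is needed for `d` nested quantifiers. -/
def levelBound (N d : ℕ) : ℕ := (level N d).factorial * (level N d + 2)

theorem levelBound_mono (N : ℕ) : Monotone (levelBound N) := fun _ _ h =>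
  Nat.mul_le_mul (Nat.factorial_le (level_mono N h)) (Nat.add_le_add_right (level_mono N h) 2)

theorem le_quantBound {N d D : ℕ} (h : d ≤ D) (x : List ℤ) {y : ℕ}
    (hy : y ≤ (level N d).factorial * (level N d * (x.map Int.natAbs).sum + 2)) :
    y ≤ quantBound (levelBound N D) x := by
  refine hy.trans (le_trans ?_ (Nat.mul_le_mul_right _ (levelBound_mono N h)))
  rw [levelBound, mul_assoc]
  refine Nat.mul_le_mul_left _ ?_
  nlinarith [Nat.zero_le ((x.map Int.natAbs).sum)]

/-- One number, the code, bounds both the quantifier depth (through `d`) and the coefficients of all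
equations (through `N`). Each quantifier spends one level: elements of R are matched by integers
within the bound, and arbitrary integers by elements of R. The bound itself is fixed by `D`, while
`d` decreases. -/
theorem formulaVal_iff {n N D : ℕ} {k : ℕ} (φ : addGroupLang.BoundedFormula (Fin n) k) {d : ℕ}
    (hd : formulaCode φ ≤ d) (hD : d ≤ D) (hN : formulaCode φ + 1 ≤ N) {x : List ℤ}
    (hx : x.length = n + k) {X : ℕ → residueSystems}
    (h : Similar (level N d) x.length X (ints x)) :
    formulaVal (levelBound N D) x (formulaCode φ) = true ↔
      φ.Realize (fun i => X i) (fun j => X (n + j)) := by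
  induction φ generalizing d x X with
  | falsum =>
    rw [formulaCode, formulaVal_falsum]
    simp [FirstOrder.Language.BoundedFormula.Realize]
  | @equal k t s =>
    rw [formulaCode] at hN
    rw [formulaCode, formulaVal_equal]
    have hvar : ∀ b, varIndex n k b < x.length := by
      rw [hx]
      rintro (i | j)
      · exact i.2.trans_le (Nat.le_add_right _ _)
      · exact Nat.add_lt_add_left j.2 n
    have hX : (Sum.elim (fun i : Fin n => X i) fun j : Fin k => X (n + j)) =
        fun b => X (varIndex n k b) := by
      funext b
      rcases b with i | j <;> rfl
    obtain ⟨a, ha, ha'⟩ := exists_linear_form (varIndex n k) t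
    obtain ⟨b, hb, hb'⟩ := exists_linear_form (varIndex n k) s
    -- The tag 1 of an equation in its code absorbs one of the two units in the bounds for the
    -- coefficients of its sides; the other is the unit in `hN`.
    have hab : ∀ i, ((a - b) i).natAbs ≤ level N d := fun i => by
      have h1 := ha i
      have h2 := hb i
      have h3 := Nat.add_le_pair (termCode (varIndex n k) t) (termCode (varIndex n k) s)
      have h4 := Nat.add_le_pair 1
        (Nat.pair (termCode (varIndex n k) t) (termCode (varIndex n k) s))
      have h5 : N ≤ level N d := level_mono N (Nat.zero_le d)
      rw [Pi.sub_apply]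
      omega
    have key := h.relation (a - b) hab
    rw [sum_ints, int_eq_zero] at key
    simp only [Pi.sub_apply, sub_smul, sub_mul, sum_sub_distrib, sub_eq_zero] at key
    rw [← (ha' _ hvar).1, ← (hb' _ hvar).1, ← (ha' _ hvar).2, ← (hb' _ hvar).2] at key
    rw [← key, FirstOrder.Language.BoundedFormula.Realize, hX]
  | rel r => exact r.elim
  | imp φ ψ ihφ ihψ =>
    rw [formulaCode] at hd hN
    have h1 := Nat.add_le_pair (formulaCode φ) (formulaCode ψ)
    have h2 := Nat.add_le_pair 2 (Nat.pair (formulaCode φ) (formulaCode ψ))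
    rw [formulaCode, formulaVal_imp, ihφ (by omega) hD (by omega) hx h,
      ihψ (by omega) hD (by omega) hx h]
    rfl
  | @all k φ ih =>
    rw [formulaCode] at hd hN
    have h1 := Nat.add_le_pair 3 (formulaCode φ)
    -- The tag 3 makes the code of a universal formula positive, so a level is left to spend.
    obtain ⟨d, rfl⟩ : ∃ e, d = e + 1 := ⟨d - 1, by omega⟩
    rw [level_succ] at h
    have step : ∀ (y : ℤ) (Y : residueSystems),
        Similar (level N d) (x.length + 1) (Function.update X x.length Y) (ints (x ++ [y])) →
        (formulaVal (levelBound N D) (x ++ [y]) (formulaCode φ) = true ↔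
          φ.Realize (fun i => X i) (Fin.snoc (fun j : Fin k => X (n + j)) Y)) := fun y Y hs => by
      rw [ih (x := x ++ [y]) (X := Function.update X x.length Y) (d := d) (by omega) (by omega)
        (by omega) (by simp [hx, add_assoc]) (by simpa using hs)]
      have e1 : (fun i : Fin n => Function.update X x.length Y i) = fun i : Fin n => X i :=
        funext fun i => Function.update_of_ne (by omega) _ _
      have e2 : (fun j : Fin (k + 1) => Function.update X x.length Y (n + j)) =
          Fin.snoc (fun j : Fin k => X (n + j)) Y := by
        funext j
        refine Fin.lastCases ?_ (fun j => ?_) j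
        · rw [Fin.snoc_last, Fin.val_last, ← hx, Function.update_self]
        · rw [Fin.snoc_castSucc, Fin.val_castSucc, Function.update_of_ne (by omega)]
      rw [e1, e2]
    rw [formulaCode, formulaVal_all, FirstOrder.Language.BoundedFormula.Realize]
    constructor
    · intro hall Y
      obtain ⟨y, hy, hs⟩ := h.exists_int Y
      exact (step y Y hs).1 (hall y (le_quantBound (by omega) x hy))
    · intro hall y _
      obtain ⟨Y, hs⟩ := h.exists_residueSystem y
      exact (step y Y hs).2 (hall Y)

end residueSystems

/-! ### Turing functionals from computable functions -/

namespace IsTuringFunctional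

theorem of_eq {Φ Ψ : (ℕ → ℕ) → ℕ →. ℕ} (h : IsTuringFunctional Φ) (H : ∀ A n, Φ A n = Ψ A n) :
    IsTuringFunctional Ψ :=
  (funext fun A => funext (H A) : Φ = Ψ) ▸ h

theorem of_partrec {f : ℕ →. ℕ} (hf : Nat.Partrec f) : IsTuringFunctional fun _ => f := by
  induction hf with
  | zero => exact IsTuringFunctional.zero
  | succ => exact IsTuringFunctional.succ
  | left => exact IsTuringFunctional.left
  | right => exact IsTuringFunctional.right
  | pair _ _ h1 h2 => exact h1.pair h2
  | comp _ _ h1 h2 => exact h1.comp h2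
  | prec _ _ h1 h2 => exact h1.prec h2
  | rfind _ h => exact h.rfind

theorem of_computable {f : ℕ → ℕ} (hf : Computable f) :
    IsTuringFunctional fun _ n => Part.some (f n) :=
  of_partrec (Partrec.nat_iff.1 hf)

theorem comp_computable {f : ℕ → ℕ} (hf : Computable f) {h : (ℕ → ℕ) → ℕ → ℕ}
    (hh : IsTuringFunctional fun A n => Part.some (h A n)) :
    IsTuringFunctional fun A n => Part.some (f (h A n)) := by
  have := (of_computable hf).comp hh
  simpa using this

theorem total_pair {g h : (ℕ → ℕ) → ℕ → ℕ}
    (hg : IsTuringFunctional fun A n => Part.some (g A n))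
    (hh : IsTuringFunctional fun A n => Part.some (h A n)) :
    IsTuringFunctional fun A n => Part.some (Nat.pair (g A n) (h A n)) := by
  have := hg.pair hh
  simpa [Seq.seq] using this

theorem total_comp {g h : (ℕ → ℕ) → ℕ → ℕ}
    (hg : IsTuringFunctional fun A n => Part.some (g A n))
    (hh : IsTuringFunctional fun A n => Part.some (h A n)) :
    IsTuringFunctional fun A n => Part.some (g A (h A n)) := by
  have := hg.comp hh
  simpa using this

/-- Primitive recursion on the length, where each step queries the oracle once and appends the
answer to the coded list. -/
theorem encode_prefix :
    IsTuringFunctional fun A n => Part.some (Encodable.encode ((List.range n).map A)) := by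
  have hcat : Computable fun m : ℕ => Encodable.encode
      (((Encodable.decode (α := List ℕ) m.unpair.1).getD []) ++ [m.unpair.2]) :=
    (Primrec.encode.comp (Primrec.list_concat.comp
      (Primrec.option_getD.comp (Primrec.decode.comp (Primrec.fst.comp Primrec.unpair))
        (Primrec.const [])) (Primrec.snd.comp Primrec.unpair))).to_comp
  have hy : Computable fun m : ℕ => m.unpair.2.unpair.1 :=
    (Primrec.fst.comp (Primrec.unpair.comp (Primrec.snd.comp Primrec.unpair))).to_comp
  have hi : Computable fun m : ℕ => m.unpair.2.unpair.2 :=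
    (Primrec.snd.comp (Primrec.unpair.comp (Primrec.snd.comp Primrec.unpair))).to_comp
  have hstep := comp_computable hcat
    (total_pair (of_computable hi) (total_comp oracle (of_computable hy)))
  have hrec := ((of_computable (Computable.const (Encodable.encode ([] : List ℕ)))).prec
    hstep).comp (of_computable (f := fun n => Nat.pair 0 n)
      (Primrec.nat_pair.comp (.const 0) .id).to_comp)
  refine hrec.of_eq fun A n => ?_
  simp only [Part.bind_eq_bind, Part.bind_some, Nat.unpaired, Nat.unpair_pair]
  induction n with
  | zero => rfl
  | succ n ih =>
    simp only [ih, Part.bind_some, Encodable.encodek, Option.getD_some, List.range_succ,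
      List.map_append, List.map_cons, List.map_nil]

/-- A computable function of the argument and of finite initial segments of the oracle gives a
Turing functional: one searches for an initial segment on which the function has a value. -/
theorem exists_of_prefix {g : ℕ → List ℕ → Option ℕ} (hg : Computable₂ g) :
    ∃ Φ : (ℕ → ℕ) → ℕ →. ℕ, IsTuringFunctional Φ ∧ ∀ (A : ℕ → ℕ) (n v : ℕ),
      (∃ s, (g n ((List.range s).map A)).isSome) →
      (∀ s w, g n ((List.range s).map A) = some w → w = v) → Φ A n = Part.some v := by
  have hG : Computable fun m : ℕ => Encodable.encode
      (g m.unpair.1 ((Encodable.decode (α := List ℕ) m.unpair.2).getD [])) :=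
    Computable.encode.comp (hg.comp (Computable.fst.comp Computable.unpair)
      (Primrec.option_getD.comp (Primrec.decode.comp (Primrec.snd.comp Primrec.unpair))
        (Primrec.const [])).to_comp)
  have hΘ := comp_computable hG (total_pair left
    (total_comp encode_prefix right))
  simp only [Nat.unpair_pair, Encodable.encodek, Option.getD_some] at hΘ
  -- The code of `none` is 0 and that of `some w` is w + 1. Truncated subtraction turns the search
  -- for a value into a search for a zero, and a predecessor later recovers w.
  have hT := comp_computable (f := fun n => 1 - n)
    (Primrec.nat_sub.comp (.const 1) .id).to_comp hΘ
  have hres := (comp_computable Primrec.pred.to_comp hΘ).comp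
    ((of_computable Computable.id).pair hT.rfind)
  refine ⟨_, hres, fun A n v ⟨s, hs⟩ hv => ?_⟩
  set F : ℕ → ℕ := fun s => Encodable.encode (g n ((List.range s).map A)) with hF
  have hfind : ∃ t ∈ Nat.rfind fun t => Part.some (decide (1 - F t = 0)), 1 - F t = 0 := by
    have hdom : (Nat.rfind fun t => Part.some (decide (1 - F t = 0))).Dom := by
      refine Nat.rfind_dom.2 ⟨s, ?_, fun _ => trivial⟩
      obtain ⟨w, hw⟩ := Option.isSome_iff_exists.1 hs
      simp [hF, hw]
    refine ⟨_, Part.get_mem hdom, ?_⟩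
    have := Nat.rfind_spec (Part.get_mem hdom)
    simpa using this
  obtain ⟨t, ht, hFt⟩ := hfind
  have hval : F t = v + 1 := by
    rcases hgt : g n ((List.range t).map A) with _ | w
    · simp [hF, hgt] at hFt
    · simp [hF, hgt, hv t w hgt]
  have hrf : (Nat.rfind fun t => Part.some (decide (1 - F t = 0))) = Part.some t :=
    Part.eq_some_iff.2 ht
  simp only [Nat.unpair_pair, Part.map_eq_map, Part.map_some, Part.bind_eq_bind, id, Seq.seq]
  rw [hrf]
  simp only [Part.map_some, Part.bind_some, Nat.unpair_pair, Part.some_inj]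
  change (F t).pred = v
  rw [hval]
  rfl

end IsTuringFunctional

/-! ### Computability of the prime numbers -/

theorem Primrec.nat_prime : PrimrecPred Nat.Prime := by
  have h : PrimrecRel fun m n : ℕ => m ∣ n → m = 1 :=
    ((Primrec.nat_dvd.not).or (Primrec.eq.comp .fst (.const 1))).of_eq fun p => by
      dsimp only
      tauto
  have h2 : PrimrecPred fun n : ℕ => ∀ m < n, m ∣ n → m = 1 :=
    h.forall_lt.comp Primrec.id Primrec.id
  exact ((Primrec.nat_le.comp (.const 2) .id).and h2).of_eq fun n => Nat.prime_def_lt.symm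

/-- Bertrand's postulate bounds the search for the next prime, so that it is primitive recursive. -/
theorem nth_prime_succ (i : ℕ) : Nat.nth Nat.Prime (i + 1) =
    (List.range (2 * Nat.nth Nat.Prime i + 1)).findIdx
      fun q => decide (Nat.nth Nat.Prime i < q ∧ q.Prime) := by
  have hinf := Nat.infinite_setOfPred_prime
  obtain ⟨b, hb, hib, hb2⟩ := Nat.exists_prime_lt_and_le_two_mul (Nat.nth Nat.Prime i)
    (Nat.prime_nth_prime i).ne_zero
  have hle : Nat.nth Nat.Prime (i + 1) ≤ b := by
    rw [← Nat.nth_count hb]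
    refine Nat.nth_monotone hinf (Nat.succ_le_of_lt ?_)
    rw [← Nat.nth_count hb] at hib
    exact (Nat.nth_lt_nth hinf).1 hib
  rw [eq_comm, List.findIdx_eq (by simpa using by omega)]
  refine ⟨?_, fun j hj => ?_⟩
  · rw [List.getElem_range, decide_eq_true_iff]
    exact ⟨(Nat.nth_lt_nth hinf).2 i.lt_succ_self, Nat.prime_nth_prime _⟩
  simp only [List.getElem_range, decide_eq_false_iff_not, not_and]
  intro h1 h2
  rw [← Nat.nth_count h2] at h1 hj
  have h3 := (Nat.nth_lt_nth hinf).1 h1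
  have h4 := (Nat.nth_lt_nth hinf).1 hj
  omega

theorem Primrec.nth_prime : Primrec (Nat.nth Nat.Prime) := by
  have hstep : Primrec₂ fun (_ : ℕ) (p : ℕ) =>
      (List.range (2 * p + 1)).findIdx fun q => decide (p < q ∧ q.Prime) :=
    Primrec.list_findIdx (Primrec.list_range.comp (Primrec.succ.comp
      (Primrec.nat_double.comp .snd)))
      ((Primrec.nat_lt.comp (Primrec.snd.comp .fst) .snd).and
        (Primrec.nat_prime.comp .snd)).decide.to₂
  refine (Primrec.nat_rec₁ (Nat.nth Nat.Prime 0) hstep).of_eq fun n => ?_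
  induction n with
  | zero => rfl
  | succ n ih => rw [nth_prime_succ, ← ih]

theorem Primrec.nthPrimePow : Primrec₂ nthPrimePow :=
  Primrec.nat_pow.comp (Primrec.nth_prime.comp .fst) (Primrec.succ.comp .snd)

/-! ### The computable tree presentation -/

theorem oracleJoin_pair {n : ℕ} (X : Fin n → ℕ → ℕ) (i : Fin n) (k : ℕ) :
    oracleJoin X (Nat.pair i k) = X i k := by
  simp [oracleJoin]

theorem List.getD_map_range {X : ℕ → ℕ} {s q : ℕ} (h : q < s) :
    ((List.range s).map X).getD q 0 = X q := by
  simp [List.getD, h]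

theorem List.map_range_getD (σ : List ℕ) : (List.range σ.length).map (fun q => σ.getD q 0) = σ := by
  refine List.ext_getElem (by simp) fun i h1 h2 => ?_
  simp [h2]

theorem isInitialSegment_iff {σ : List ℕ} {X : ℕ → ℕ} :
    IsInitialSegment σ X ↔ ∀ q < σ.length, σ.getD q 0 = X q := by
  constructor
  · intro h q hq
    rw [IsInitialSegment] at h
    rw [h]
    exact List.getD_map_range hq
  · intro h
    rw [IsInitialSegment]
    conv_lhs => rw [← List.map_range_getD σ]
    exact List.map_congr_left fun q hq => h q (List.mem_range.1 hq)

namespace zHatTreeStructure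

/-- Pairing is strictly increasing in its second argument, so each column is an initial stretch of
its indices. This replaces columns by conditions on single entries of `σ`. -/
theorem mem_tree_iff (σ : List ℕ) : σ ∈ zHatTreeStructure.tree ↔
    ∀ i l, (Nat.pair i l < σ.length → σ.getD (Nat.pair i l) 0 < nthPrimePow i l) ∧
      (Nat.pair i (l + 1) < σ.length →
        σ.getD (Nat.pair i (l + 1)) 0 ≡ σ.getD (Nat.pair i l) 0 [MOD nthPrimePow i l]) := by
  refine forall_congr' fun i => ?_
  have hex : ∃ k, σ.length ≤ Nat.pair i k := ⟨σ.length, Nat.right_le_pair i _⟩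
  have hlt : ∀ l, Nat.pair i l < σ.length ↔ l < Nat.find hex := fun l => by
    refine ⟨fun h => ?_, fun h => not_le.1 (Nat.find_min hex h)⟩
    by_contra hl
    have h2 := Nat.find_spec hex
    rcases (not_lt.1 hl).lt_or_eq with h' | h'
    · have := Nat.pair_lt_pair_right i h'
      omega
    · rw [h'] at h2
      omega
  have hcol : column i σ = (List.range (Nat.find hex)).map fun l => σ.getD (Nat.pair i l) 0 := by
    conv_lhs => rw [← List.map_range_getD σ]
    exact column_map_range _ i _ _ (Nat.find_min' hex (Nat.right_le_pair i _)) hlt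
  change column i σ ∈ padicTree _ ↔ _
  rw [hcol]
  simp only [hlt]
  constructor
  · rintro ⟨h1, h2⟩ l
    simp only [List.length_map, List.length_range] at h1 h2
    refine ⟨fun h => ?_, fun h => ?_⟩
    · have := h1 l h
      rwa [List.getD_map_range h] at this
    · have := h2 l h
      rwa [List.getD_map_range h, List.getD_map_range (Nat.lt_of_succ_lt h)] at this
  · intro h
    refine ⟨fun l hl => ?_, fun l hl => ?_⟩ <;>
      simp only [List.length_map, List.length_range] at hl
    · rw [List.getD_map_range hl]
      exact (h l).1 hl
    · rw [List.getD_map_range hl, List.getD_map_range (Nat.lt_of_succ_lt hl)]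
      exact (h l).2 hl

theorem mem_tree_of_prefix {σ τ : List ℕ} (h : σ <+: τ) (hτ : τ ∈ zHatTreeStructure.tree) :
    σ ∈ zHatTreeStructure.tree := by
  obtain ⟨ρ, rfl⟩ := h
  rw [mem_tree_iff] at hτ ⊢
  have key : ∀ q < σ.length, (σ ++ ρ).getD q 0 = σ.getD q 0 := fun q hq =>
    List.getD_append _ _ _ _ hq
  have hlen : ∀ {q}, q < σ.length → q < (σ ++ ρ).length := fun hq => by
    rw [List.length_append]
    omega
  refine fun i l => ⟨fun h => ?_, fun h => ?_⟩
  · rw [← key _ h]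
    exact (hτ i l).1 (hlen h)
  · rw [← key _ h, ← key _ ((Nat.pair_lt_pair_right i l.lt_succ_self).trans h)]
    exact (hτ i l).2 (hlen h)

theorem computable_tree : ComputablePred fun σ : List ℕ => σ ∈ zHatTreeStructure.tree := by
  have hi : Primrec fun p : ℕ × List ℕ => p.1.unpair.1 :=
    Primrec.fst.comp (Primrec.unpair.comp .fst)
  have hl : Primrec fun p : ℕ × List ℕ => p.1.unpair.2 :=
    Primrec.snd.comp (Primrec.unpair.comp .fst)
  have hP := Primrec.nthPrimePow.comp hi hl
  have hm : Primrec fun p : ℕ × List ℕ => p.2.getD p.1 0 :=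
    (Primrec.list_getD 0).comp .snd .fst
  have hq := Primrec.nat_pair.comp hi (Primrec.succ.comp hl)
  have hn : Primrec fun p : ℕ × List ℕ =>
      p.2.getD (Nat.pair p.1.unpair.1 (p.1.unpair.2 + 1)) 0 := (Primrec.list_getD 0).comp .snd hq
  have hR : PrimrecRel fun (m : ℕ) (σ : List ℕ) =>
      σ.getD m 0 < nthPrimePow m.unpair.1 m.unpair.2 ∧
      (¬ Nat.pair m.unpair.1 (m.unpair.2 + 1) < σ.length ∨
        σ.getD (Nat.pair m.unpair.1 (m.unpair.2 + 1)) 0 % nthPrimePow m.unpair.1 m.unpair.2 =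
          σ.getD m 0 % nthPrimePow m.unpair.1 m.unpair.2) :=
    (Primrec.nat_lt.comp hm hP).and
      ((Primrec.nat_lt.comp hq (Primrec.list_length.comp .snd)).not.or
        (Primrec.eq.comp (Primrec.nat_mod.comp hn hP) (Primrec.nat_mod.comp hm hP)))
  refine ((hR.forall_mem_list.comp (Primrec.list_range.comp Primrec.list_length)
    Primrec.id).of_eq fun σ => ?_).computablePred
  rw [mem_tree_iff]
  simp only [List.mem_range, id]
  constructor
  · intro h i l
    refine ⟨fun hlt => by simpa using (h _ hlt).1, fun hlt => ?_⟩
    have := (h _ ((Nat.pair_lt_pair_right i l.lt_succ_self).trans hlt)).2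
    rw [Nat.unpair_pair] at this
    exact this.resolve_left (not_not.2 hlt)
  · intro h m hm
    have := h m.unpair.1 m.unpair.2
    rw [Nat.pair_unpair] at this
    exact ⟨this.1 hm, or_iff_not_imp_left.2 fun hlt => this.2 (not_not.1 hlt)⟩

/-- The extension of a string of the tree by repetition of the last entries of its columns. -/
def extend (σ : List ℕ) (i : ℕ) : ℕ → ℕ
  | 0 => if Nat.pair i 0 < σ.length then σ.getD (Nat.pair i 0) 0 else 0
  | l + 1 => if Nat.pair i (l + 1) < σ.length then σ.getD (Nat.pair i (l + 1)) 0 else extend σ i l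

theorem extend_eq {σ : List ℕ} {i l : ℕ} (h : Nat.pair i l < σ.length) :
    extend σ i l = σ.getD (Nat.pair i l) 0 := by
  cases l <;> rw [extend, if_pos h]

theorem exists_path {σ : List ℕ} (h : σ ∈ zHatTreeStructure.tree) :
    ∃ X : zHatTreeStructure.Dom, IsInitialSegment σ X.1 := by
  rw [mem_tree_iff] at h
  refine ⟨⟨fun m => extend σ m.unpair.1 m.unpair.2, (mem_paths_zHatTree _).2
    ⟨fun i l => ?_, fun i l => ?_⟩⟩, isInitialSegment_iff.2 fun q hq => ?_⟩
  · rw [Nat.unpair_pair]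
    induction l with
    | zero =>
      rw [extend]
      split_ifs with h0
      · exact (h i 0).1 h0
      · exact NeZero.pos _
    | succ l ih =>
      rw [extend]
      split_ifs with h0
      · exact (h i (l + 1)).1 h0
      · exact ih.trans_le (Nat.le_of_dvd (NeZero.pos _) (nthPrimePow_dvd i l.le_succ))
  · simp only [Nat.unpair_pair]
    rw [extend]
    split_ifs with h0
    · rw [extend_eq ((Nat.pair_lt_pair_right i l.lt_succ_self).trans h0)]
      exact (h i l).2 h0
    · rfl
  · dsimp only
    rw [extend_eq (by rwa [Nat.pair_unpair]), Nat.pair_unpair]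

theorem isComputablePresentation : zHatTreeStructure.IsComputablePresentation where
  isTree _ _ := mem_tree_of_prefix
  computable := computable_tree
  extendible _ := exists_path
  functional := by
    have hP : Primrec fun p : ℕ × List ℕ => nthPrimePow p.1.unpair.1 p.1.unpair.2 :=
      Primrec.nthPrimePow.comp (Primrec.fst.comp (Primrec.unpair.comp .fst))
        (Primrec.snd.comp (Primrec.unpair.comp .fst))
    have hq : ∀ i : ℕ, Primrec fun p : ℕ × List ℕ => Nat.pair i p.1 := fun i =>
      Primrec.nat_pair.comp (.const i) .fst
    have hget : ∀ i : ℕ, Primrec fun p : ℕ × List ℕ => p.2.getD (Nat.pair i p.1) 0 := fun i =>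
      (Primrec.list_getD 0).comp .snd (hq i)
    have hlt : ∀ i : ℕ, PrimrecPred fun p : ℕ × List ℕ => Nat.pair i p.1 < p.2.length := fun i =>
      Primrec.nat_lt.comp (hq i) (Primrec.list_length.comp .snd)
    intro n f
    cases f with
    | zero =>
      refine ⟨_, IsTuringFunctional.zero, fun X k => ?_⟩
      have := funMap_zero X k.unpair.1 k.unpair.2
      rw [Nat.pair_unpair] at this
      rw [this]
    | neg =>
      have hg : Primrec₂ fun (k : ℕ) (τ : List ℕ) => if Nat.pair 0 k < τ.length then
          some ((nthPrimePow k.unpair.1 k.unpair.2 - τ.getD (Nat.pair 0 k) 0) %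
            nthPrimePow k.unpair.1 k.unpair.2) else none :=
        Primrec.ite (hlt 0) (Primrec.option_some.comp
          (Primrec.nat_mod.comp (Primrec.nat_sub.comp hP (hget 0)) hP)) (.const none)
      obtain ⟨Φ, hΦ, H⟩ := IsTuringFunctional.exists_of_prefix hg.to_comp
      refine ⟨Φ, hΦ, fun X k => H _ _ _ ⟨Nat.pair 0 k + 1, by simp⟩ fun s w hw => ?_⟩
      rw [List.length_map, List.length_range] at hw
      split_ifs at hw with h0
      have := funMap_neg X k.unpair.1 k.unpair.2
      rw [Nat.pair_unpair] at this
      rw [List.getD_map_range h0, show Nat.pair 0 k = Nat.pair ((0 : Fin 1) : ℕ) k from rfl,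
        oracleJoin_pair, Option.some_inj] at hw
      rw [← hw, ← this]
    | add =>
      have hg : Primrec₂ fun (k : ℕ) (τ : List ℕ) => if Nat.pair 1 k < τ.length then
          some ((τ.getD (Nat.pair 0 k) 0 + τ.getD (Nat.pair 1 k) 0) %
            nthPrimePow k.unpair.1 k.unpair.2) else none :=
        Primrec.ite (hlt 1) (Primrec.option_some.comp
          (Primrec.nat_mod.comp (Primrec.nat_add.comp (hget 0) (hget 1)) hP)) (.const none)
      obtain ⟨Φ, hΦ, H⟩ := IsTuringFunctional.exists_of_prefix hg.to_comp
      refine ⟨Φ, hΦ, fun X k => H _ _ _ ⟨Nat.pair 1 k + 1, by simp⟩ fun s w hw => ?_⟩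
      rw [List.length_map, List.length_range] at hw
      split_ifs at hw with h1
      -- Pairing is increasing in its first argument, so a prefix containing the entry of the second
      -- summand also contains that of the first.
      have h0 := (Nat.pair_lt_pair_left k Nat.zero_lt_one).trans h1
      have := funMap_add X k.unpair.1 k.unpair.2
      rw [Nat.pair_unpair] at this
      rw [List.getD_map_range h0, List.getD_map_range h1,
        show Nat.pair 0 k = Nat.pair ((0 : Fin 2) : ℕ) k from rfl,
        show Nat.pair 1 k = Nat.pair ((1 : Fin 2) : ℕ) k from rfl,
        oracleJoin_pair, oracleJoin_pair, Option.some_inj] at hw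
      rw [← hw, ← this]

end zHatTreeStructure

/-! ### Certificates for the similarity of a tuple of integers and a tuple of paths -/

namespace PrimrecPred

variable {α β : Type*} [Primcodable α] [Primcodable β]

theorem forall_mem {f : β → List α} {p : β → α → Prop} (hf : Primrec f)
    (hp : PrimrecPred fun q : β × α => p q.1 q.2) : PrimrecPred fun b => ∀ a ∈ f b, p b a :=
  (PrimrecRel.forall_mem_list (R := fun a b => p b a)
    (hp.comp (Primrec.snd.pair Primrec.fst))).comp hf Primrec.id

theorem exists_mem {f : β → List α} {p : β → α → Prop} (hf : Primrec f)
    (hp : PrimrecPred fun q : β × α => p q.1 q.2) : PrimrecPred fun b => ∃ a ∈ f b, p b a :=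
  (PrimrecRel.exists_mem_list (R := fun a b => p b a)
    (hp.comp (Primrec.snd.pair Primrec.fst))).comp hf Primrec.id

theorem forall_lt' {f : β → ℕ} {p : β → ℕ → Prop} (hf : Primrec f)
    (hp : PrimrecPred fun q : β × ℕ => p q.1 q.2) : PrimrecPred fun b => ∀ i < f b, p b i :=
  (forall_mem (Primrec.list_range.comp hf) hp).of_eq fun b => by simp

theorem exists_lt' {f : β → ℕ} {p : β → ℕ → Prop} (hf : Primrec f)
    (hp : PrimrecPred fun q : β × ℕ => p q.1 q.2) : PrimrecPred fun b => ∃ i < f b, p b i :=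
  (exists_mem (Primrec.list_range.comp hf) hp).of_eq fun b => by simp

theorem imp {p q : α → Prop} (hp : PrimrecPred p) (hq : PrimrecPred q) :
    PrimrecPred fun a => p a → q a :=
  (hp.not.or hq).of_eq fun _ => imp_iff_not_or.symm

end PrimrecPred

/-- The linear form with coefficients `a` in `n` variables. -/
def linearForm (n : ℕ) (a x : List ℤ) : ℤ := ((List.range n).map fun i => a.getD i 0 * x.getD i 0).sum

theorem linearForm_eq (n : ℕ) (a x : List ℤ) :
    linearForm n a x = ∑ i ∈ Finset.range n, a.getD i 0 * x.getD i 0 := by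
  rw [linearForm, ← List.sum_toFinset _ List.nodup_range, List.toFinset_range]

/-- The integral vectors of length `n` with entries of absolute value at most `N`. -/
def vectorBox (N n : ℕ) : List (List ℤ) :=
  Nat.rec [([] : List ℤ)] (fun _ L => L.flatMap fun v => (intsUpTo N).map fun z => z :: v) n

theorem vectorBox_succ (N n : ℕ) : vectorBox N (n + 1) =
    (vectorBox N n).flatMap fun v => (intsUpTo N).map fun z => z :: v := rfl

theorem mem_vectorBox {N n : ℕ} {v : List ℤ} :
    v ∈ vectorBox N n ↔ v.length = n ∧ ∀ z ∈ v, z.natAbs ≤ N := by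
  induction n generalizing v with
  | zero =>
    rw [show vectorBox N 0 = [([] : List ℤ)] from rfl, List.mem_singleton,
      List.length_eq_zero_iff]
    exact ⟨fun h => ⟨h, by simp [h]⟩, fun h => h.1⟩
  | succ n ih =>
    simp only [vectorBox_succ, List.mem_flatMap, List.mem_map, mem_intsUpTo, ih]
    constructor
    · rintro ⟨w, ⟨rfl, hw⟩, z, hz, rfl⟩
      exact ⟨rfl, by simpa using ⟨hz, hw⟩⟩
    · rintro ⟨hl, hv⟩
      cases v with
      | nil => simp at hl
      | cons z w =>
        rw [List.forall_mem_cons] at hv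
        exact ⟨w, ⟨by simpa using hl, hv.2⟩, z, hv.1, rfl⟩

/-- The `i`-th unit vector. -/
def unitVector (i : ℕ) : List ℤ := (List.range i).map (fun _ => (0 : ℤ)) ++ [1]

theorem unitVector_getD (i j : ℕ) : (unitVector i).getD j 0 = if j = i then 1 else 0 := by
  rcases lt_trichotomy j i with h | rfl | h
  · rw [if_neg h.ne, unitVector, List.getD_append _ _ _ _ (by simpa using h)]
    simp [h]
  · simp [unitVector]
  · rw [if_neg h.ne', List.getD_eq_default _ _ (by simpa [unitVector] using h)]

/-- The string `σ` shows that the entries of the `n` paths in the oracle are congruent to the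
integers `x`, modulo the prime powers that divide `M`. -/
def ResidueCert (M n : ℕ) (x : List ℤ) (σ : List ℕ) : Prop :=
  ∀ i < n, ∀ j < M, ∀ l < M, nthPrimePow j l ∣ M → Nat.pair i (Nat.pair j l) < σ.length ∧
    (nthPrimePow j l : ℤ) ∣ x.getD i 0 - σ.getD (Nat.pair i (Nat.pair j l)) 0

/-- The string `σ` shows that the linear form `a` vanishes, by an equation that is enumerated into
the positive atomic diagram. -/
def ZeroCert (n : ℕ) (σ : List ℕ) (a : List ℤ) : Prop :=
  ∃ e < σ.length, σ.getD e 0 = 1 ∧ e.unpair.1 = n ∧ ∀ i < n,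
    termVal (unitVector i) e.unpair.2.unpair.1.unpair.2.unpair.2.unpair.1 -
      termVal (unitVector i) e.unpair.2.unpair.1.unpair.2.unpair.2.unpair.2 = a.getD i 0

/-- The string `σ` shows that the linear form `a` does not vanish, by a nonzero residue. -/
def NonzeroCert (n : ℕ) (σ : List ℕ) (a : List ℤ) : Prop :=
  ∃ k < σ.length, (∀ i < n, Nat.pair i k < σ.length) ∧
    ¬ (nthPrimePow k.unpair.1 k.unpair.2 : ℤ) ∣
      linearForm n a ((List.range n).map fun i => (σ.getD (Nat.pair i k) 0 : ℤ))

/-- The string `σ` shows that the tuple of integers `x` is similar to the tuple of paths in the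
oracle, up to the level `N`. -/
def SimilarCert (N n : ℕ) (x : List ℤ) (σ : List ℕ) : Prop :=
  x.length = n ∧ ResidueCert N.factorial n x σ ∧ ∀ a ∈ vectorBox N n,
    (linearForm n a x = 0 ∧ ZeroCert n σ a) ∨ (linearForm n a x ≠ 0 ∧ NonzeroCert n σ a)

/-! ### Primitive recursiveness of the certificates -/

section Primrec

open Primrec

variable {β : Type*} [Primcodable β]

theorem primrec_linearForm {n : β → ℕ} {a x : β → List ℤ} (hn : Primrec n) (ha : Primrec a)
    (hx : Primrec x) : Primrec fun b => linearForm (n b) (a b) (x b) := by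
  have h1 : Primrec fun b => (List.range (n b)).map fun i => (a b).getD i 0 * (x b).getD i 0 :=
    list_map (list_range.comp hn) (int_mul.comp ((list_getD 0).comp (ha.comp .fst) .snd)
      ((list_getD 0).comp (hx.comp .fst) .snd)).to₂
  refine (list_foldr h1 (const 0) (int_add.comp (fst.comp snd) (snd.comp snd)).to₂).of_eq
    fun b => ?_
  rw [linearForm, List.sum_eq_foldr]

theorem primrec_vectorBox : Primrec₂ vectorBox := by
  have h : Primrec₂ fun (p : ℕ × ℕ) (q : ℕ × List (List ℤ)) =>
      q.2.flatMap fun v => (intsUpTo p.1).map fun z => z :: v :=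
    list_flatMap (snd.comp snd) (list_map
      (primrec_intsUpTo.comp (fst.comp (fst.comp fst))) (list_cons.comp snd (snd.comp fst)).to₂).to₂
  exact nat_rec' snd (const [([] : List ℤ)]) h

theorem primrec_unitVector : Primrec unitVector :=
  list_concat.comp (list_map list_range (const 0).to₂) (const 1)

theorem primrec_residueCert {M n : β → ℕ} {x : β → List ℤ} {σ : β → List ℕ} (hM : Primrec M)
    (hn : Primrec n) (hx : Primrec x) (hσ : Primrec σ) :
    PrimrecPred fun b => ResidueCert (M b) (n b) (x b) (σ b) := by
  refine PrimrecPred.forall_lt' hn (PrimrecPred.forall_lt' (hM.comp fst)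
    (PrimrecPred.forall_lt' (hM.comp (fst.comp fst)) ?_))
  have hb : Primrec fun q : ((β × ℕ) × ℕ) × ℕ => q.1.1.1 := fst.comp (fst.comp fst)
  have hi : Primrec fun q : ((β × ℕ) × ℕ) × ℕ => q.1.1.2 := snd.comp (fst.comp fst)
  have hj : Primrec fun q : ((β × ℕ) × ℕ) × ℕ => q.1.2 := snd.comp fst
  have hl : Primrec fun q : ((β × ℕ) × ℕ) × ℕ => q.2 := snd
  have hP := nthPrimePow.comp hj hl
  have hq := nat_pair.comp hi (nat_pair.comp hj hl)
  exact (nat_dvd.comp hP (hM.comp hb)).imp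
    ((nat_lt.comp hq (list_length.comp (hσ.comp hb))).and
      (natCast_dvd_int.comp hP (int_sub.comp ((list_getD 0).comp (hx.comp hb) hi)
        (int_ofNat.comp ((list_getD 0).comp (hσ.comp hb) hq)))))

theorem primrec_zeroCert {n : β → ℕ} {σ : β → List ℕ} {a : β → List ℤ}
    (hn : Primrec n) (hσ : Primrec σ) (ha : Primrec a) :
    PrimrecPred fun b => ZeroCert (n b) (σ b) (a b) := by
  refine PrimrecPred.exists_lt' (list_length.comp hσ) (PrimrecPred.and ?_ (PrimrecPred.and ?_ ?_))
  · exact Primrec.eq.comp ((list_getD 0).comp (hσ.comp fst) snd) (const 1)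
  · exact Primrec.eq.comp (fst.comp (unpair.comp snd)) (hn.comp fst)
  · refine PrimrecPred.forall_lt' (hn.comp fst) ?_
    have hc : Primrec fun q : (β × ℕ) × ℕ =>
        q.1.2.unpair.2.unpair.1.unpair.2.unpair.2.unpair :=
      unpair.comp (snd.comp (unpair.comp (snd.comp (unpair.comp (fst.comp (unpair.comp
        (snd.comp (unpair.comp (snd.comp fst)))))))))
    have hu : Primrec fun q : (β × ℕ) × ℕ => unitVector q.2 := primrec_unitVector.comp snd
    exact Primrec.eq.comp (int_sub.comp (primrec_termVal.comp hu (fst.comp hc))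
      (primrec_termVal.comp hu (snd.comp hc)))
      ((list_getD 0).comp (ha.comp (fst.comp fst)) snd)

theorem primrec_nonzeroCert {n : β → ℕ} {σ : β → List ℕ} {a : β → List ℤ}
    (hn : Primrec n) (hσ : Primrec σ) (ha : Primrec a) :
    PrimrecPred fun b => NonzeroCert (n b) (σ b) (a b) := by
  refine PrimrecPred.exists_lt' (list_length.comp hσ) (PrimrecPred.and ?_ (PrimrecPred.not ?_))
  · exact PrimrecPred.forall_lt' (hn.comp fst) (nat_lt.comp (nat_pair.comp snd (snd.comp fst))
      (list_length.comp (hσ.comp (fst.comp fst))))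
  · refine natCast_dvd_int.comp (nthPrimePow.comp (fst.comp (unpair.comp snd))
      (snd.comp (unpair.comp snd))) (primrec_linearForm (hn.comp fst) (ha.comp fst) ?_)
    exact list_map (list_range.comp (hn.comp fst)) (int_ofNat.comp ((list_getD 0).comp
      (hσ.comp (fst.comp fst)) (nat_pair.comp snd (snd.comp fst)))).to₂

theorem primrec_similarCert {N n : β → ℕ} {x : β → List ℤ} {σ : β → List ℕ} (hN : Primrec N)
    (hn : Primrec n) (hx : Primrec x) (hσ : Primrec σ) :
    PrimrecPred fun b => SimilarCert (N b) (n b) (x b) (σ b) := by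
  refine (Primrec.eq.comp (list_length.comp hx) hn).and
    ((primrec_residueCert (nat_factorial.comp hN) hn hx hσ).and
      (PrimrecPred.forall_mem (primrec_vectorBox.comp hN hn) ?_))
  have hz := Primrec.eq.comp (primrec_linearForm (hn.comp fst) snd (hx.comp fst))
    (const (α := β × List ℤ) 0)
  exact (hz.and (primrec_zeroCert (hn.comp fst) (hσ.comp fst) snd)).or
    (hz.not.and (primrec_nonzeroCert (hn.comp fst) (hσ.comp fst) snd))

theorem primrec_level : Primrec₂ residueSystems.level :=
  nat_iterate snd fst (nat_mul.comp (const 2) (nat_pow.comp snd (const 2))).to₂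

theorem primrec_levelBound : Primrec₂ residueSystems.levelBound :=
  nat_mul.comp (nat_factorial.comp primrec_level) (nat_add.comp primrec_level (const 2))

end Primrec

/-! ### Tree-decidability -/

namespace zHatTreeStructure

open residueSystems Finset

/-- The compatible systems of residues of the entries of a tuple of paths, followed by zeros. -/
noncomputable def systems {n : ℕ} (X : Fin n → zHatTreeStructure.Dom) (i : ℕ) : residueSystems :=
  if h : i < n then equivResidueSystems.symm (X ⟨i, h⟩) else 0

theorem systems_val {n : ℕ} (X : Fin n → zHatTreeStructure.Dom) (i : Fin n) :
    systems X i = equivResidueSystems.symm (X i) := dif_pos i.2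

theorem proj_systems {n : ℕ} (X : Fin n → zHatTreeStructure.Dom) (i : Fin n) (j l : ℕ) :
    proj (nthPrimePow j l) (systems X i) =
      (((X i).1 (Nat.pair j l) : ℤ) : ZMod (nthPrimePow j l)) := by
  rw [systems_val, Int.cast_natCast]
  exact proj_eq_path (equivResidueSystems.apply_symm_apply _) j l

theorem realize_iff {n : ℕ} (X : Fin n → zHatTreeStructure.Dom)
    (α : addGroupLang.Formula (Fin n)) :
    α.Realize X ↔ α.Realize fun i : Fin n => systems X i := by
  rw [← FirstOrder.Language.StrongHomClass.realize_formula equivResidueSystems.symm]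
  refine iff_of_eq (congrArg _ (funext fun i => ?_))
  exact (systems_val X i).symm

variable {n : ℕ} (X : Fin n → zHatTreeStructure.Dom) (D : Set ℕ)

/-- The oracle given by a tuple of paths and a set. -/
noncomputable def oracle : ℕ → ℕ :=
  oracleJoin (Fin.snoc (α := fun _ => ℕ → ℕ) (fun i => (X i).1) (charFun D))

theorem oracle_path (i : Fin n) (k : ℕ) : oracle X D (Nat.pair i k) = (X i).1 k := by
  have := oracleJoin_pair (Fin.snoc (α := fun _ => ℕ → ℕ) (fun i => (X i).1) (charFun D))
    i.castSucc k
  rwa [Fin.snoc_castSucc, Fin.val_castSucc] at this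

theorem oracle_set (k : ℕ) : oracle X D (Nat.pair n k) = charFun D k := by
  have := oracleJoin_pair (Fin.snoc (α := fun _ => ℕ → ℕ) (fun i => (X i).1) (charFun D))
    (Fin.last n) k
  rwa [Fin.snoc_last, Fin.val_last] at this

theorem charFun_eq_one {D : Set ℕ} {k : ℕ} : charFun D k = 1 ↔ k ∈ D := by
  by_cases h : k ∈ D <;> simp [charFun, h]

theorem varIndex_lt (b : Fin n ⊕ Fin 0) : varIndex n 0 b < n := by
  rcases b with i | j
  · exact i.2
  · exact j.elim0

theorem sum_unitVector {a : ℕ → ℤ} {i m : ℕ} (hi : i < m) :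
    ∑ j ∈ range m, a j * (unitVector i).getD j 0 = a i := by
  simp only [unitVector_getD]
  simp [hi]

/-- The coefficients of a term are its values at the unit vectors, so they are computable from its
code. -/
theorem realize_eq_sum (t : addGroupLang.Term (Fin n ⊕ Fin 0)) (Y : ℕ → residueSystems) :
    t.realize (fun b => Y (varIndex n 0 b)) =
      ∑ i ∈ range n, termVal (unitVector i) (termCode (varIndex n 0) t) • Y i := by
  obtain ⟨a, -, ha⟩ := exists_linear_form (varIndex n 0) t
  rw [(ha n varIndex_lt).2]
  refine sum_congr rfl fun i hi => ?_
  rw [(ha n varIndex_lt).1, sum_unitVector (mem_range.1 hi)]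

theorem realize_equal (t s : addGroupLang.Term (Fin n ⊕ Fin 0)) :
    FirstOrder.Language.Formula.Realize (t.bdEqual s) X ↔
      ∑ i ∈ range n, (termVal (unitVector i) (termCode (varIndex n 0) t) -
        termVal (unitVector i) (termCode (varIndex n 0) s)) • systems X i = 0 := by
  rw [realize_iff, FirstOrder.Language.Formula.Realize,
    FirstOrder.Language.BoundedFormula.realize_bdEqual]
  have hX : (Sum.elim (fun i : Fin n => systems X i) (default : Fin 0 → residueSystems)) =
      fun b => systems X (varIndex n 0 b) := by
    funext b
    rcases b with i | j
    · rfl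
    · exact j.elim0
  simp only [hX, realize_eq_sum, sub_smul, sum_sub_distrib, sub_eq_zero]

theorem godel_equal (t s : addGroupLang.Term (Fin n ⊕ Fin 0)) :
    godel (t.bdEqual s : addGroupLang.Formula (Fin n)) = Nat.pair n (Nat.pair 1
      (Nat.pair (termCode (varIndex n 0) t) (termCode (varIndex n 0) s))) := rfl

/-- The functions of tuples that are given by terms. -/
def termFunctions (α : Type) : AddSubgroup ((α → residueSystems) → residueSystems) where
  carrier := {f | ∃ t : addGroupLang.Term α, ∀ Y, t.realize Y = f Y}
  zero_mem' := ⟨.func AddGroupFunc.zero ![], fun _ => rfl⟩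
  add_mem' := fun {f g} ⟨t, ht⟩ ⟨s, hs⟩ => ⟨.func AddGroupFunc.add ![t, s], fun Y => by
    rw [Pi.add_apply, ← ht, ← hs]
    rfl⟩
  neg_mem' := fun {f} ⟨t, ht⟩ => ⟨.func AddGroupFunc.neg ![t], fun Y => by
    rw [Pi.neg_apply, ← ht]
    rfl⟩

/-- Functions given by terms form a subgroup that contains the coordinates, hence all integral
combinations of them. Evaluation at integral unit vectors recovers the coefficients because ℤ embeds
in R. -/
theorem exists_term (a : ℕ → ℤ) : ∃ t : addGroupLang.Term (Fin n ⊕ Fin 0),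
    ∀ i < n, termVal (unitVector i) (termCode (varIndex n 0) t) = a i := by
  have hmem : (∑ i : Fin n, a i • fun Y : Fin n ⊕ Fin 0 → residueSystems => Y (Sum.inl i)) ∈
      termFunctions (Fin n ⊕ Fin 0) :=
    sum_mem fun i _ => zsmul_mem (K := termFunctions (Fin n ⊕ Fin 0))
      (show _ ∈ termFunctions _ from ⟨.var (Sum.inl i), fun _ => rfl⟩) _
  obtain ⟨t, ht⟩ := hmem
  refine ⟨t, fun i hi => int_injective ?_⟩
  have h1 := ht fun b => ints (unitVector i) (varIndex n 0 b)
  rw [realize_eq_sum, sum_ints, sum_unitVector hi] at h1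
  rw [h1, Finset.sum_apply]
  have h2 := sum_ints (unitVector i) a n
  rw [sum_unitVector hi, ← Fin.sum_univ_eq_sum_range (fun j => a j • ints (unitVector i) j)] at h2
  exact h2

variable {X D}

/-- The bounded ranges in the certificate reach all prime powers dividing `M`, and these determine
the residue modulo `M`. -/
theorem residue_of_residueCert {M s : ℕ} [NeZero M] {x : List ℤ}
    (h : ResidueCert M n x ((List.range s).map (oracle X D))) (i : ℕ) (hi : i < n) :
    proj M (systems X i) = (x.getD i 0 : ZMod M) := by
  rw [proj_eq_intCast_iff]
  intro j l hd
  obtain ⟨hj, hl⟩ := lt_of_nthPrimePow_dvd (NeZero.ne M) hd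
  obtain ⟨hlt, hdvd⟩ := h i hi j hj l hl hd
  rw [List.length_map, List.length_range] at hlt
  rw [List.getD_map_range hlt, oracle_path X D ⟨i, hi⟩] at hdvd
  rw [proj_systems X ⟨i, hi⟩, ZMod.intCast_eq_intCast_iff_dvd_sub]
  exact hdvd

theorem eq_zero_of_zeroCert (hD : IsEnumeration D (zHatTreeStructure.posAtomicDiagram X)) {s : ℕ}
    {a : List ℤ} (h : ZeroCert n ((List.range s).map (oracle X D)) a) :
    ∑ i ∈ range n, a.getD i 0 • systems X i = 0 := by
  obtain ⟨e, he, h1, hn, ha⟩ := h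
  rw [List.length_map, List.length_range] at he
  -- The position `e` lies in column `n` of the oracle, which is the enumeration `D`. So the answer
  -- 1 means that its second component is in `D`.
  rw [List.getD_map_range he, ← Nat.pair_unpair e, hn, oracle_set, charFun_eq_one] at h1
  have hq : e.unpair.2.unpair.1 ∈ zHatTreeStructure.posAtomicDiagram X := by
    rw [hD]
    exact ⟨e.unpair.2.unpair.2, by rwa [Nat.pair_unpair]⟩
  obtain ⟨α, hα, hr, hc⟩ := hq
  cases hα with
  | equal t s =>
    rw [godel_equal] at hc
    rw [← hc] at ha
    simp only [Nat.unpair_pair] at ha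
    rw [realize_equal] at hr
    rw [← hr]
    exact sum_congr rfl fun i hi => by rw [ha i (mem_range.1 hi)]
  | rel r => exact r.elim

theorem proj_sum_systems (a : List ℤ) (k : ℕ) :
    proj (nthPrimePow k.unpair.1 k.unpair.2) (∑ i ∈ range n, a.getD i 0 • systems X i) =
      ((linearForm n a ((List.range n).map fun i => (oracle X D (Nat.pair i k) : ℤ)) : ℤ) :
        ZMod (nthPrimePow k.unpair.1 k.unpair.2)) := by
  rw [map_sum, linearForm_eq, Int.cast_sum]
  refine sum_congr rfl fun i hi => ?_
  have hi' := mem_range.1 hi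
  have : ((List.range n).map fun i => (oracle X D (Nat.pair i k) : ℤ)).getD i 0 =
      (X ⟨i, hi'⟩).1 k := by
    rw [← oracle_path X D ⟨i, hi'⟩]
    simp [List.getD, hi']
  rw [map_zsmul, proj_systems X ⟨i, hi'⟩, this, Nat.pair_unpair, zsmul_eq_mul, Int.cast_mul]

theorem ne_zero_of_nonzeroCert {s : ℕ} {a : List ℤ}
    (h : NonzeroCert n ((List.range s).map (oracle X D)) a) :
    ∑ i ∈ range n, a.getD i 0 • systems X i ≠ 0 := by
  obtain ⟨k, -, hlt, hk⟩ := h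
  intro h0
  refine hk ?_
  simp only [List.length_map, List.length_range] at hlt
  rw [List.map_congr_left fun i hi => by
    rw [List.getD_map_range (hlt i (List.mem_range.1 hi))] ]
  rw [← ZMod.intCast_zmod_eq_zero_iff_dvd, ← proj_sum_systems, h0, map_zero]

theorem similar_of_cert (hD : IsEnumeration D (zHatTreeStructure.posAtomicDiagram X)) {N s : ℕ}
    {x : List ℤ} (h : SimilarCert N n x ((List.range s).map (oracle X D))) :
    Similar N n (systems X) (ints x) := by
  obtain ⟨-, hres, hrel⟩ := h
  refine ⟨fun i hi => ?_, fun a ha => ?_⟩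
  · rw [residue_of_residueCert hres i hi, ints, proj_int]
  · have hget : ∀ i ∈ range n, ((List.range n).map a).getD i 0 = a i := fun i hi => by
      simp [List.getD, mem_range.1 hi]
    have hv : (List.range n).map a ∈ vectorBox N n := mem_vectorBox.2
      ⟨by simp, fun z hz => by
        obtain ⟨i, -, rfl⟩ := List.mem_map.1 hz
        exact ha i⟩
    have h1 : linearForm n ((List.range n).map a) x = ∑ i ∈ range n, a i * x.getD i 0 := by
      rw [linearForm_eq]
      exact sum_congr rfl fun i hi => by rw [hget i hi]
    have h2 : ∑ i ∈ range n, ((List.range n).map a).getD i 0 • systems X i =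
        ∑ i ∈ range n, a i • systems X i := sum_congr rfl fun i hi => by rw [hget i hi]
    rw [sum_ints, int_eq_zero, ← h1, ← h2]
    rcases hrel _ hv with ⟨hz, hc⟩ | ⟨hz, hc⟩
    · exact iff_of_true (eq_zero_of_zeroCert hD hc) hz
    · exact iff_of_false (ne_zero_of_nonzeroCert hc) hz

open Filter in
-- There are finitely many requirements, and each is witnessed by finitely many oracle values. So
-- all of them are visible in every sufficiently long prefix.
theorem eventually_similarCert (hD : IsEnumeration D (zHatTreeStructure.posAtomicDiagram X))
    {N : ℕ} {x : List ℤ} (hx : x.length = n) (h : Similar N n (systems X) (ints x)) :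
    ∀ᶠ s in atTop, SimilarCert N n x ((List.range s).map (oracle X D)) := by
  have hev : ∀ q : ℕ, ∀ᶠ s in atTop, q < s := eventually_gt_atTop
  refine (eventually_const.2 hx).and (Eventually.and ?_ ?_)
  · refine (eventually_all_finite (Set.finite_Iio n)).2 fun i hi =>
      (eventually_all_finite (Set.finite_Iio N.factorial)).2 fun j _ =>
      (eventually_all_finite (Set.finite_Iio N.factorial)).2 fun l _ => ?_
    have hi' : i < n := hi
    filter_upwards [hev (Nat.pair i (Nat.pair j l))] with s hs hd
    refine ⟨by simpa using hs, ?_⟩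
    rw [List.getD_map_range hs, oracle_path X D ⟨i, hi'⟩, ← ZMod.intCast_eq_intCast_iff_dvd_sub,
      ← proj_systems X ⟨i, hi'⟩]
    refine proj_eq_intCast_of_dvd hd ?_
    rw [h.residue i hi', ints, proj_int]
  · refine (eventually_all_finite (vectorBox N n).finite_toSet).2 fun a ha => ?_
    obtain ⟨hlen, ha⟩ := mem_vectorBox.1 ha
    -- Beyond the length of `a` the coefficient is the default 0, so the bound holds at every index.
    have hrel := h.relation (fun i => a.getD i 0) fun i => by
      rcases lt_or_ge i a.length with hi | hi
      · rw [List.getD_eq_getElem _ _ hi]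
        exact ha _ (List.getElem_mem hi)
      · rw [List.getD_eq_default _ _ hi]
        simp
    rw [sum_ints, int_eq_zero, ← linearForm_eq] at hrel
    by_cases hz : linearForm n a x = 0
    · obtain ⟨t, ht⟩ := exists_term (n := n) fun i => a.getD i 0
      -- The relation is presented as the equation `t = u` with a right side all of whose
      -- coefficients are zero. As it is true, `D` enumerates it.
      obtain ⟨u, hu⟩ := exists_term (n := n) fun _ => 0
      have hmem : godel (t.bdEqual u : addGroupLang.Formula (Fin n)) ∈
          zHatTreeStructure.posAtomicDiagram X := by
        refine ⟨_, .equal t u, (realize_equal X t u).2 ?_, rfl⟩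
        rw [← hrel.2 hz]
        exact sum_congr rfl fun i hi => by
          rw [ht i (mem_range.1 hi), hu i (mem_range.1 hi), sub_zero]
      rw [hD] at hmem
      obtain ⟨y, hy⟩ := hmem
      filter_upwards [hev (Nat.pair n (Nat.pair (godel (t.bdEqual u)) y))] with s hs
      refine Or.inl ⟨hz, _, by simpa using hs, ?_, by rw [Nat.unpair_pair], fun i hi => ?_⟩
      · rw [List.getD_map_range hs, oracle_set]
        exact charFun_eq_one.2 hy
      · simp only [Nat.unpair_pair, godel_equal]
        rw [ht i hi, hu i hi, sub_zero]
    -- An element of R whose residues modulo all prime powers vanish is zero.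
    · have hne : ∃ k : ℕ, ¬ (nthPrimePow k.unpair.1 k.unpair.2 : ℤ) ∣
          linearForm n a ((List.range n).map fun i => (oracle X D (Nat.pair i k) : ℤ)) := by
        by_contra hall
        push Not at hall
        refine hz (hrel.1 (ext_nthPrimePow fun i l => ?_))
        have h1 := hall (Nat.pair i l)
        rw [← ZMod.intCast_zmod_eq_zero_iff_dvd, ← proj_sum_systems (X := X)] at h1
        rw [map_zero]
        rwa [Nat.unpair_pair] at h1
      obtain ⟨k, hk⟩ := hne
      have hall := (eventually_all_finite (Set.finite_Iio n)).2
        fun (i : ℕ) (_ : i ∈ Set.Iio n) => hev (Nat.pair i k)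
      filter_upwards [hev k, hall] with s hs hs'
      refine Or.inr ⟨hz, k, by simpa using hs, fun i hi => by simpa using hs' i hi, ?_⟩
      rw [List.map_congr_left fun i hi => by
        rw [List.getD_map_range (hs' i (List.mem_range.1 hi))] ]
      exact hk

theorem formulaVal_iff_realize (hD : IsEnumeration D (zHatTreeStructure.posAtomicDiagram X))
    (α : addGroupLang.Formula (Fin n)) {s : ℕ} {x : List ℤ}
    (h : SimilarCert (level (formulaCode α + 1) (formulaCode α)) n x
      ((List.range s).map (oracle X D))) :
    formulaVal (levelBound (formulaCode α + 1) (formulaCode α)) x (formulaCode α) = true ↔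
      α.Realize X := by
  have hs := similar_of_cert hD h
  obtain ⟨hx, -⟩ := h
  subst hx
  rw [realize_iff, formulaVal_iff (n := x.length) α le_rfl le_rfl le_rfl rfl hs,
    FirstOrder.Language.Formula.Realize]
  exact iff_of_eq (congrArg _ (Subsingleton.elim _ _))

theorem isTreeDecidable : zHatTreeStructure.IsTreeDecidable := by
  classical
  -- The length of the prefix also encodes the candidate tuple, as its first component. Every tuple
  -- is thus tried with arbitrarily long prefixes.
  let x : List ℕ → List ℤ := fun σ =>
    (Encodable.decode (α := List ℤ) σ.length.unpair.1).getD []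
  have hx : Primrec x := Primrec.option_getD.comp (Primrec.decode.comp (Primrec.fst.comp
    (Primrec.unpair.comp Primrec.list_length))) (.const [])
  let g : ℕ → List ℕ → Option ℕ := fun m σ =>
    if SimilarCert (level (m.unpair.2 + 1) m.unpair.2) m.unpair.1 (x σ) σ then
      some (if formulaVal (levelBound (m.unpair.2 + 1) m.unpair.2) (x σ) m.unpair.2 = true
        then 1 else 0)
    else none
  have hg : Primrec₂ g := by
    have hn : Primrec fun p : ℕ × List ℕ => p.1.unpair.1 :=
      Primrec.fst.comp (Primrec.unpair.comp .fst)
    have hc : Primrec fun p : ℕ × List ℕ => p.1.unpair.2 :=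
      Primrec.snd.comp (Primrec.unpair.comp .fst)
    have hc' := Primrec.succ.comp hc
    exact Primrec.ite (primrec_similarCert (primrec_level.comp hc' hc) hn (hx.comp .snd) .snd)
      (Primrec.option_some.comp (Primrec.ite (Primrec.eq.comp (primrec_formulaVal.comp
        (((primrec_levelBound.comp hc' hc).pair (hx.comp .snd)).pair hc)) (.const true))
        (.const 1) (.const 0))) (.const none)
  obtain ⟨Φ, hΦ, H⟩ := IsTuringFunctional.exists_of_prefix hg.to_comp
  refine ⟨Φ, hΦ, fun n α X D hD => H (oracle X D) _ _ ?_ fun s w hw => ?_⟩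
  · obtain ⟨y, hy, hsim⟩ := exists_similar_ints
      (level (formulaCode α + 1) (formulaCode α)) n (systems X)
    obtain ⟨k, hk⟩ := Filter.eventually_atTop.1 (eventually_similarCert hD hy hsim)
    refine ⟨Nat.pair (Encodable.encode y) k, ?_⟩
    have hs := hk (Nat.pair (Encodable.encode y) k) (Nat.right_le_pair _ _)
    have hxy : x ((List.range (Nat.pair (Encodable.encode y) k)).map (oracle X D)) = y := by
      simp [x]
    simp only [g, godel, Nat.unpair_pair, hxy, if_pos hs]
    rfl
  · simp only [g, godel, Nat.unpair_pair] at hw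
    split_ifs at hw with h1 h2
    · rw [if_pos ((formulaVal_iff_realize hD α h1).1 h2)]
      exact (Option.some.inj hw).symm
    · rw [if_neg fun h => h2 ((formulaVal_iff_realize hD α h1).2 h)]
      exact (Option.some.inj hw).symm

end zHatTreeStructure

/-! ### Existential-atomic formulas -/

theorem natAbs_termCoeff_le {α : Type} [DecidableEq α] (v : α → ℕ) (a : α)
    (t : addGroupLang.Term α) : (termCoeff a t).natAbs ≤ termCode v t + 1 := by
  induction t with
  | var b =>
    rw [termCoeff]
    split_ifs <;> simp
  | func f ts ih =>
    cases f with
    | zero => simp [termCoeff]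
    | neg =>
      have h1 := ih 0
      have h2 := Nat.add_le_pair 2 (termCode v (ts 0))
      rw [termCoeff, termCode, Int.natAbs_neg]
      omega
    | add =>
      have h1 := ih 0
      have h2 := ih 1
      have h3 := Nat.add_le_pair (termCode v (ts 0)) (termCode v (ts 1))
      have h4 := Nat.add_le_pair 3 (Nat.pair (termCode v (ts 0)) (termCode v (ts 1)))
      rw [termCoeff, termCode]
      omega

/-- Terms are additive, so the contribution of `G` splits off. This brings an equation into the form
∑ aᵢFᵢ = bG. -/
theorem realize_add_termCoeff {n : ℕ} (t : addGroupLang.Term (Fin n ⊕ Fin 1))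
    (F : Fin n → residueSystems) (G : residueSystems) :
    t.realize (Sum.elim F fun _ => G) =
      t.realize (Sum.elim F fun _ => 0) + termCoeff (Sum.inr 0) t • G := by
  induction t with
  | var b =>
    rcases b with i | j
    · simp [termCoeff]
    · obtain rfl := Subsingleton.elim j 0
      simp [termCoeff]
  | func f ts ih =>
    cases f with
    | zero =>
      rw [termCoeff, zero_smul, add_zero]
      rfl
    | neg =>
      rw [termCoeff, neg_smul]
      change - (ts 0).realize _ = - (ts 0).realize _ + _
      rw [ih 0, neg_add]
    | add =>
      rw [termCoeff, add_smul]
      change (ts 0).realize _ + (ts 1).realize _ = (ts 0).realize _ + (ts 1).realize _ + _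
      rw [ih 0, ih 1]
      abel

/-- The coefficient `b` of an equation `∑ aᵢ Fᵢ = b G`. -/
def eqCoeff {n : ℕ} (t s : addGroupLang.Term (Fin n ⊕ Fin 1)) : ℤ :=
  termCoeff (Sum.inr 0) s - termCoeff (Sum.inr 0) t

/-- The left-hand side of an equation `∑ aᵢ Fᵢ = b G`. -/
def eqLeft {n : ℕ} (t s : addGroupLang.Term (Fin n ⊕ Fin 1)) (F : Fin n → residueSystems) :
    residueSystems :=
  t.realize (Sum.elim F fun _ => 0) - s.realize (Sum.elim F fun _ => 0)

section Equation

variable {n : ℕ} {t s : addGroupLang.Term (Fin n ⊕ Fin 1)}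

theorem eqCoeff_ne_zero (h : ProperEquation t s) : eqCoeff t s ≠ 0 :=
  sub_ne_zero.2 (Ne.symm h)

theorem realize_sub_realize (t s : addGroupLang.Term (Fin n ⊕ Fin 1)) (F : Fin n → residueSystems)
    (G : residueSystems) :
    t.realize (Sum.elim F fun _ => G) - s.realize (Sum.elim F fun _ => G) =
      eqLeft t s F - eqCoeff t s • G := by
  rw [realize_add_termCoeff t, realize_add_termCoeff s, eqLeft, eqCoeff, sub_smul]
  abel

theorem realize_existsEq_iff (t s : addGroupLang.Term (Fin n ⊕ Fin 1))
    (F : Fin n → residueSystems) :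
    (existsEq t s).Realize F ↔ ∃ G, eqCoeff t s • G = eqLeft t s F := by
  rw [existsEq, FirstOrder.Language.Formula.Realize, FirstOrder.Language.BoundedFormula.realize_ex]
  refine exists_congr fun G => ?_
  rw [FirstOrder.Language.BoundedFormula.realize_bdEqual]
  have : (Fin.snoc (default : Fin 0 → residueSystems) G : Fin 1 → residueSystems) = fun _ => G := by
    funext j
    obtain rfl : j = Fin.last 0 := by omega
    exact Fin.snoc_last _ _
  rw [this, ← sub_eq_zero, realize_sub_realize, sub_eq_zero, eq_comm]

/-- The existential quantifier is ¬∀¬, and each negation is an implication to falsum. This accounts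
for the nesting, which `eqVal` unpairs. -/
theorem godel_existsEq (t s : addGroupLang.Term (Fin n ⊕ Fin 1)) :
    godel (existsEq t s) = Nat.pair n (Nat.pair 2 (Nat.pair (Nat.pair 3 (Nat.pair 2
      (Nat.pair (Nat.pair 1 (Nat.pair (termCode (varIndex n 1) t) (termCode (varIndex n 1) s)))
        (Nat.pair 0 0)))) (Nat.pair 0 0))) := rfl

/-- With this bound a modulus depending only on the Gödel number m suffices: for a proper equation b
divides m!, and b has p-adic valuation at most m. -/
theorem natAbs_eqCoeff_le (t s : addGroupLang.Term (Fin n ⊕ Fin 1)) :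
    (eqCoeff t s).natAbs ≤ godel (existsEq t s) := by
  have h1 := natAbs_termCoeff_le (varIndex n 1) (Sum.inr 0) t
  have h2 := natAbs_termCoeff_le (varIndex n 1) (Sum.inr 0) s
  rw [godel_existsEq, eqCoeff]
  generalize termCode (varIndex n 1) t = a at *
  generalize termCode (varIndex n 1) s = b at *
  have e1 := Nat.add_le_pair a b
  have e2 := Nat.add_le_pair 1 (Nat.pair a b)
  have e3 := Nat.add_le_pair (Nat.pair 1 (Nat.pair a b)) (Nat.pair 0 0)
  have e4 := Nat.add_le_pair 2 (Nat.pair (Nat.pair 1 (Nat.pair a b)) (Nat.pair 0 0))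
  have e5 := Nat.add_le_pair 3 (Nat.pair 2 (Nat.pair (Nat.pair 1 (Nat.pair a b)) (Nat.pair 0 0)))
  have e6 := Nat.add_le_pair (Nat.pair 3 (Nat.pair 2 (Nat.pair (Nat.pair 1 (Nat.pair a b))
    (Nat.pair 0 0)))) (Nat.pair 0 0)
  have e7 := Nat.add_le_pair 2 (Nat.pair (Nat.pair 3 (Nat.pair 2 (Nat.pair
    (Nat.pair 1 (Nat.pair a b)) (Nat.pair 0 0)))) (Nat.pair 0 0))
  have e8 := Nat.add_le_pair n (Nat.pair 2 (Nat.pair (Nat.pair 3 (Nat.pair 2 (Nat.pair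
    (Nat.pair 1 (Nat.pair a b)) (Nat.pair 0 0)))) (Nat.pair 0 0)))
  omega

/-- The value of the difference of the two sides of the equation of an existential-atomic formula,
computed from the code of the formula. -/
def eqVal (m : ℕ) (x : List ℤ) : ℤ :=
  termVal x m.unpair.2.unpair.2.unpair.1.unpair.2.unpair.2.unpair.1.unpair.2.unpair.1 -
    termVal x m.unpair.2.unpair.2.unpair.1.unpair.2.unpair.2.unpair.1.unpair.2.unpair.2

theorem primrec_eqVal : Primrec₂ eqVal := by
  have hc : Primrec fun p : ℕ × List ℤ =>
      p.1.unpair.2.unpair.2.unpair.1.unpair.2.unpair.2.unpair.1.unpair.2.unpair :=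
    Primrec.unpair.comp (Primrec.snd.comp (Primrec.unpair.comp (Primrec.fst.comp
      (Primrec.unpair.comp (Primrec.snd.comp (Primrec.unpair.comp (Primrec.snd.comp
      (Primrec.unpair.comp (Primrec.fst.comp (Primrec.unpair.comp (Primrec.snd.comp
      (Primrec.unpair.comp (Primrec.snd.comp (Primrec.unpair.comp .fst))))))))))))))
  exact Primrec.int_sub.comp (primrec_termVal.comp .snd (Primrec.fst.comp hc))
    (primrec_termVal.comp .snd (Primrec.snd.comp hc))

/-- Congruence modulo q is compatible with the operations, so a term may be evaluated at integer
representatives of its arguments. -/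
theorem proj_termVal {q : ℕ} [NeZero q] {x : List ℤ} (hx : x.length = n)
    {F : Fin n → residueSystems}
    (hF : ∀ i : Fin n, residueSystems.proj q (F i) = (x.getD i 0 : ZMod q)) (g : ℤ)
    (t : addGroupLang.Term (Fin n ⊕ Fin 1)) :
    residueSystems.proj q (t.realize (Sum.elim F fun _ => residueSystems.int g)) =
      (termVal (x ++ [g]) (termCode (varIndex n 1) t) : ZMod q) := by
  refine termVal_rel (varIndex n 1) (S := fun z f => residueSystems.proj q f = (z : ZMod q))
    (by simp) (fun z f h => by simp [h]) (fun z f w g h h' => by simp [h, h']) ?_ t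
  rintro (i | j)
  · change residueSystems.proj q (F i) = ((x ++ [g]).getD (i : ℕ) 0 : ZMod q)
    rw [List.getD_append _ _ _ _ (by rw [hx]; exact i.2)]
    exact hF i
  · obtain rfl := Subsingleton.elim j 0
    change residueSystems.proj q (residueSystems.int g) = ((x ++ [g]).getD n 0 : ZMod q)
    subst hx
    simp

theorem dvd_eqVal_iff {q : ℕ} [NeZero q] {x : List ℤ} (hx : x.length = n)
    {F : Fin n → residueSystems}
    (hF : ∀ i : Fin n, residueSystems.proj q (F i) = (x.getD i 0 : ZMod q)) (g : ℤ) :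
    (q : ℤ) ∣ eqVal (godel (existsEq t s)) (x ++ [g]) ↔
      residueSystems.proj q (eqLeft t s F - eqCoeff t s • residueSystems.int g) = 0 := by
  rw [← realize_sub_realize, map_sub, proj_termVal hx hF, proj_termVal hx hF, ← Int.cast_sub,
    ZMod.intCast_zmod_eq_zero_iff_dvd, eqVal, godel_existsEq]
  simp only [Nat.unpair_pair]

end Equation

/-! ### Loss of digits when a coefficient is cancelled -/

theorem Nat.Prime.pow_dvd_of_pow_add_dvd_mul {p l m b y : ℕ} (hp : p.Prime) (hb : b ≠ 0)
    (hbm : b ≤ m) (h : p ^ (l + m) ∣ b * y) : p ^ l ∣ y := by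
  obtain ⟨v, u, hu, rfl⟩ := Nat.exists_eq_pow_mul_and_not_dvd hb p hp.ne_one
  have hv : v ≤ m := by
    have h1 := Nat.le_of_dvd (Nat.pos_of_ne_zero hb) (dvd_mul_right (p ^ v) u)
    exact ((Nat.lt_pow_self hp.one_lt).le.trans h1).trans hbm
  obtain ⟨w, rfl⟩ := Nat.exists_eq_add_of_le hv
  rw [mul_assoc, show l + (v + w) = v + (l + w) by ring, pow_add] at h
  have h2 := Nat.dvd_of_mul_dvd_mul_left (pow_pos hp.pos v) h
  have h3 : (p ^ (l + w)).Coprime u :=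
    Nat.Coprime.pow_left _ ((Nat.Prime.coprime_iff_not_dvd hp).2 hu)
  exact (pow_dvd_pow p (Nat.le_add_right l w)).trans (h3.dvd_of_dvd_mul_left h2)

namespace residueSystems

theorem proj_nthPrimePow_eq_zero_of_zsmul {i l m : ℕ} {b : ℤ} (hb : b ≠ 0) (hbm : b.natAbs ≤ m)
    {f : residueSystems} (h : proj (nthPrimePow i (l + m)) (b • f) = 0) :
    proj (nthPrimePow i l) f = 0 := by
  obtain ⟨x, hx, hp⟩ := exists_rep f
  rw [map_zsmul, hp, zsmul_eq_mul, ← Int.cast_mul, ZMod.intCast_zmod_eq_zero_iff_dvd,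
    Int.natCast_dvd, Int.natAbs_mul] at h
  have e : nthPrimePow i (l + m) = Nat.nth Nat.Prime i ^ (l + 1 + m) := by
    rw [nthPrimePow, show l + m + 1 = l + 1 + m by ring]
  have h1 := (Nat.prime_nth_prime i).pow_dvd_of_pow_add_dvd_mul (Int.natAbs_ne_zero.2 hb) hbm
    ((dvd_of_eq e.symm).trans h)
  rw [hp, ZMod.intCast_zmod_eq_zero_iff_dvd]
  have h2 := hx (nthPrimePow i l) (nthPrimePow i (l + m)) (NeZero.ne _)
    (nthPrimePow_dvd i (Nat.le_add_right l m))
  exact (dvd_sub_right (Int.natCast_dvd.2 h1)).1 h2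

end residueSystems

namespace zHatTreeStructure

open residueSystems

/-! ### Effectively clopen sets -/

/-- The equation of a formula has a solution modulo `M`, for the tuple of paths with the given
initial segments. -/
def SolvableMod (m M : ℕ) (σs : List (List ℕ)) : Prop :=
  ∃ g < M, ∀ j < M, ∀ l < M, nthPrimePow j l ∣ M →
    (nthPrimePow j l : ℤ) ∣ eqVal m ((σs.map fun σ => (σ.getD (Nat.pair j l) 0 : ℤ)) ++ [(g : ℤ)])

/-- The initial segments determine the residues modulo `M`. -/
def Determined (M : ℕ) (σs : List (List ℕ)) : Prop :=
  ∀ σ ∈ σs, ∀ j < M, ∀ l < M, Nat.pair j l < σ.length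

section

open Primrec

theorem primrec_solvableMod : PrimrecPred fun p : ℕ × List (List ℕ) =>
    SolvableMod p.1 p.1.factorial p.2 := by
  have hM : Primrec fun p : ℕ × List (List ℕ) => p.1.factorial := nat_factorial.comp fst
  refine PrimrecPred.exists_lt' hM (PrimrecPred.forall_lt' (hM.comp fst)
    (PrimrecPred.forall_lt' (hM.comp (fst.comp fst)) ?_))
  have hb : Primrec fun q : (((ℕ × List (List ℕ)) × ℕ) × ℕ) × ℕ => q.1.1.1 :=
    fst.comp (fst.comp fst)
  have hg : Primrec fun q : (((ℕ × List (List ℕ)) × ℕ) × ℕ) × ℕ => q.1.1.2 :=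
    snd.comp (fst.comp fst)
  have hj : Primrec fun q : (((ℕ × List (List ℕ)) × ℕ) × ℕ) × ℕ => q.1.2 := snd.comp fst
  have hP := nthPrimePow.comp hj snd
  have hx : Primrec fun q : (((ℕ × List (List ℕ)) × ℕ) × ℕ) × ℕ =>
      q.1.1.1.2.map fun σ => (σ.getD (Nat.pair q.1.2 q.2) 0 : ℤ) :=
    list_map (snd.comp hb) (int_ofNat.comp ((list_getD 0).comp snd
      ((nat_pair.comp hj snd).comp fst))).to₂
  exact (nat_dvd.comp hP (hM.comp hb)).imp (natCast_dvd_int.comp hP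
    (primrec_eqVal.comp (fst.comp hb) (list_concat.comp hx (int_ofNat.comp hg))))

theorem primrec_determined : PrimrecPred fun p : ℕ × List (List ℕ) =>
    Determined p.1.factorial p.2 := by
  have hM : Primrec fun p : ℕ × List (List ℕ) => p.1.factorial := nat_factorial.comp fst
  refine PrimrecPred.forall_mem snd (PrimrecPred.forall_lt' (hM.comp fst)
    (PrimrecPred.forall_lt' (hM.comp (fst.comp fst)) ?_))
  exact nat_lt.comp (nat_pair.comp (snd.comp fst) snd)
    (list_length.comp (snd.comp (fst.comp fst)))

end

variable {n : ℕ}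

/-- As b divides m!, a solution modulo m! makes the left side ∑ aᵢFᵢ vanish modulo |b|, and then it
is divisible by b in R. Conversely, a true witness can be reduced modulo m!. -/
theorem solvableMod_iff {t s : addGroupLang.Term (Fin n ⊕ Fin 1)} (hts : ProperEquation t s)
    {m : ℕ} (hm : godel (existsEq t s) = m)
    (X : Fin n → zHatTreeStructure.Dom) (σ : Fin n → List ℕ)
    (hσ : ∀ i, IsInitialSegment (σ i) (X i).1)
    (hdet : Determined m.factorial (List.ofFn σ)) :
    SolvableMod m m.factorial (List.ofFn σ) ↔ (existsEq t s).Realize X := by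
  have hb := eqCoeff_ne_zero hts
  have hbm : (eqCoeff t s).natAbs ∣ m.factorial :=
    Nat.dvd_factorial (Int.natAbs_pos.2 hb) (hm ▸ natAbs_eqCoeff_le t s)
  have : NeZero (eqCoeff t s).natAbs := ⟨Int.natAbs_ne_zero.2 hb⟩
  have hF : ∀ {j l : ℕ}, j < m.factorial → l < m.factorial → ∀ i : Fin n,
      proj (nthPrimePow j l) (systems X i) =
        ((((List.ofFn σ).map fun σ => (σ.getD (Nat.pair j l) 0 : ℤ)).getD i 0 : ℤ) :
          ZMod (nthPrimePow j l)) := fun {j l} hj hl i => by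
    have h1 := hdet (σ i) (List.mem_ofFn.2 ⟨i, rfl⟩) j hj l hl
    rw [proj_systems, ← isInitialSegment_iff.1 (hσ i) _ h1]
    simp
  have key : ∀ {j l : ℕ} (g : ℤ), j < m.factorial → l < m.factorial →
      ((nthPrimePow j l : ℤ) ∣ eqVal m
        (((List.ofFn σ).map fun σ => (σ.getD (Nat.pair j l) 0 : ℤ)) ++ [g]) ↔
      proj (nthPrimePow j l)
        (eqLeft t s (fun i : Fin n => systems X i) - eqCoeff t s • int g) = 0) :=
    fun g hj hl => hm ▸ dvd_eqVal_iff (by simp) (hF hj hl) g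
  rw [realize_iff, realize_existsEq_iff]
  constructor
  · rintro ⟨g, -, hg⟩
    have h0 : proj m.factorial
        (eqLeft t s (fun i : Fin n => systems X i) - eqCoeff t s • int g) = ((0 : ℤ) : ZMod _) := by
      rw [proj_eq_intCast_iff]
      intro j l hd
      obtain ⟨hj, hl⟩ := lt_of_nthPrimePow_dvd (NeZero.ne _) hd
      rw [(key g hj hl).1 (hg j hj l hl hd), Int.cast_zero]
    have h1 := proj_eq_intCast_of_dvd hbm h0
    refine exists_zsmul_eq ?_
    rw [map_sub, map_zsmul, zsmul_eq_mul,
      (ZMod.intCast_zmod_eq_zero_iff_dvd _ _).2 (Int.natAbs_dvd.2 dvd_rfl), zero_mul, sub_zero,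
      Int.cast_zero] at h1
    exact h1
  · rintro ⟨G, hG⟩
    obtain ⟨g, hg, hGg⟩ := exists_proj_eq m.factorial G
    refine ⟨g, hg, fun j hj l hl hd => (key g hj hl).2 ?_⟩
    rw [← hG, ← smul_sub, map_zsmul, map_sub, proj_eq_intCast_of_dvd hd hGg, proj_int, sub_self,
      smul_zero]

theorem exists_determined (X : Fin n → zHatTreeStructure.Dom) (M : ℕ) :
    ∃ σ : Fin n → List ℕ, Determined M (List.ofFn σ) ∧
      ∀ i, IsInitialSegment (σ i) (X i).1 := by
  -- Pairing is monotone in both arguments, so this length exceeds every position with both indices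
  -- below `M`.
  refine ⟨fun i => (List.range (Nat.pair M M)).map (X i).1, fun σ hσ j hj l hl => ?_, fun i => ?_⟩
  · obtain ⟨i, rfl⟩ := List.mem_ofFn.1 hσ
    rw [List.length_map, List.length_range]
    exact (Nat.pair_lt_pair_left l hj).trans (Nat.pair_lt_pair_right M hl)
  · rw [IsInitialSegment, List.length_map, List.length_range]

/-- Initial segments that determine the residues modulo m! decide the formula either way, so both
collections of basic open sets are even decidable. -/
theorem uniformlyEffectivelyClopen :
    zHatTreeStructure.UniformlyEffectivelyClopen properExistentialAtomic := by
  constructor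
  · refine ⟨fun p => Determined p.1.factorial p.2 ∧ SolvableMod p.1 p.1.factorial p.2,
      (primrec_determined.and primrec_solvableMod).computablePred.to_re, ?_⟩
    rintro n _ ⟨t, s, hts, rfl⟩ X
    generalize hm : godel (existsEq t s) = m
    constructor
    · intro h
      obtain ⟨σ, hdet, hσ⟩ := exists_determined X m.factorial
      exact ⟨σ, ⟨hdet, (solvableMod_iff hts hm X σ hσ hdet).2 h⟩, hσ⟩
    · rintro ⟨σ, ⟨hdet, h⟩, hσ⟩
      exact (solvableMod_iff hts hm X σ hσ hdet).1 h
  · refine ⟨fun p => Determined p.1.factorial p.2 ∧ ¬ SolvableMod p.1 p.1.factorial p.2,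
      (primrec_determined.and primrec_solvableMod.not).computablePred.to_re, ?_⟩
    rintro n _ ⟨t, s, hts, rfl⟩ X
    generalize hm : godel (existsEq t s) = m
    constructor
    · intro h
      obtain ⟨σ, hdet, hσ⟩ := exists_determined X m.factorial
      exact ⟨σ, ⟨hdet, fun hs => h ((solvableMod_iff hts hm X σ hσ hdet).1 hs)⟩, hσ⟩
    · rintro ⟨σ, ⟨hdet, h⟩, hσ⟩ hr
      exact h ((solvableMod_iff hts hm X σ hσ hdet).2 hr)

/-! ### Computable witnesses -/

theorem satisfiesEq_iff (t s : addGroupLang.Term (Fin n ⊕ Fin 1))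
    (X : Fin n → zHatTreeStructure.Dom) (G : zHatTreeStructure.Dom) :
    zHatTreeStructure.SatisfiesEq t s X G ↔
      eqCoeff t s • equivResidueSystems.symm G =
        eqLeft t s fun i : Fin n => systems X i := by
  have h : (Sum.elim (fun i : Fin n => systems X i) fun _ : Fin 1 => equivResidueSystems.symm G) =
      equivResidueSystems.symm ∘ Sum.elim X fun _ => G := by
    funext b
    rcases b with i | j
    · exact systems_val X i
    · rfl
  rw [TreeStructure.SatisfiesEq, ← equivResidueSystems.symm.injective.eq_iff,
    ← FirstOrder.Language.HomClass.realize_term equivResidueSystems.symm,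
    ← FirstOrder.Language.HomClass.realize_term equivResidueSystems.symm, ← h, ← sub_eq_zero,
    realize_sub_realize, sub_eq_zero, eq_comm]

/-- The solution of the equation of a formula modulo a power of the `i`-th prime number, where the
entries of the tuple are read from an initial segment of the oracle. -/
noncomputable def solution (m i l : ℕ) (τ : List ℕ) : ℕ :=
  (List.range (nthPrimePow i (l + m))).findIdx fun g : ℕ => decide
    ((nthPrimePow i (l + m) : ℤ) ∣ eqVal m (((List.range m.unpair.1).map fun k : ℕ =>
      (τ.getD (Nat.pair k (Nat.pair i (l + m))) 0 : ℤ)) ++ [(g : ℤ)]))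

section

open Primrec

theorem primrec_solution {β : Type*} [Primcodable β] {m i l : β → ℕ} {τ : β → List ℕ}
    (hm : Primrec m) (hi : Primrec i) (hl : Primrec l) (hτ : Primrec τ) :
    Primrec fun b => solution (m b) (i b) (l b) (τ b) := by
  have hL := nat_add.comp hl hm
  have hP := nthPrimePow.comp hi hL
  have hx : Primrec fun b => (List.range (m b).unpair.1).map fun k : ℕ =>
      ((τ b).getD (Nat.pair k (Nat.pair (i b) (l b + m b))) 0 : ℤ) :=
    list_map (list_range.comp (fst.comp (unpair.comp hm)))
      (int_ofNat.comp ((list_getD 0).comp (hτ.comp fst)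
        (nat_pair.comp snd (nat_pair.comp (hi.comp fst) (hL.comp fst))))).to₂
  have hd : PrimrecPred fun q : β × ℕ => (_root_.nthPrimePow (i q.1) (l q.1 + m q.1) : ℤ) ∣
      eqVal (m q.1) (((List.range (m q.1).unpair.1).map fun k : ℕ =>
        ((τ q.1).getD (Nat.pair k (Nat.pair (i q.1) (l q.1 + m q.1))) 0 : ℤ)) ++ [(q.2 : ℤ)]) :=
    natCast_dvd_int.comp (hP.comp fst) (primrec_eqVal.comp (hm.comp fst)
      (list_concat.comp (hx.comp fst) (int_ofNat.comp snd)))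
  exact list_findIdx (list_range.comp hP) hd.decide.to₂

end

/-- The residue of `G` ensures that the search succeeds. Whichever solution it finds differs from
`G` by something killed by b modulo the exponent l + m + 1, and cancelling b leaves agreement at
exponent l + 1. -/
theorem solution_spec {t s : addGroupLang.Term (Fin n ⊕ Fin 1)} (hts : ProperEquation t s)
    (X : Fin n → zHatTreeStructure.Dom) {G : residueSystems}
    (hG : eqCoeff t s • G = eqLeft t s fun i : Fin n => systems X i) {m i l r : ℕ}
    (hm : godel (existsEq t s) = m)
    (hr : ∀ k < n, Nat.pair k (Nat.pair i (l + m)) < r) :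
    proj (nthPrimePow i l) G = (solution m i l
      ((List.range r).map (oracleJoin fun i => (X i).1)) : ZMod (nthPrimePow i l)) := by
  have hmn : m.unpair.1 = n := by rw [← hm, godel, Nat.unpair_pair]
  set x : List ℤ := (List.range m.unpair.1).map fun k : ℕ => (((List.range r).map
    (oracleJoin fun i => (X i).1)).getD (Nat.pair k (Nat.pair i (l + m))) 0 : ℤ) with hx
  have hF : ∀ k : Fin n, proj (nthPrimePow i (l + m)) (systems X k) =
      (x.getD k 0 : ZMod (nthPrimePow i (l + m))) := fun k => by
    have hk : x.getD k 0 = (X k).1 (Nat.pair i (l + m)) := by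
      rw [← oracleJoin_pair (fun i => (X i).1) k,
        ← List.getD_map_range (X := oracleJoin fun i => (X i).1) (hr k k.2)]
      simp [hx, hmn, List.getD]
    rw [proj_systems, hk, Int.cast_natCast]
  have key : ∀ g : ℕ, (nthPrimePow i (l + m) : ℤ) ∣ eqVal m (x ++ [(g : ℤ)]) ↔
      proj (nthPrimePow i (l + m)) (eqCoeff t s • (G - int g)) = 0 := fun g => by
    have h := dvd_eqVal_iff (t := t) (s := s) (by simp [hx, hmn]) hF g
    rwa [hm, ← hG, ← smul_sub] at h
  obtain ⟨g, hg, hGg⟩ := exists_proj_eq (nthPrimePow i (l + m)) G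
  have hlt : solution m i l ((List.range r).map (oracleJoin fun i => (X i).1)) <
      (List.range (nthPrimePow i (l + m))).length := by
    refine List.findIdx_lt_length.2 ⟨g, List.mem_range.2 hg, ?_⟩
    rw [decide_eq_true_iff, key, map_zsmul, map_sub, hGg, proj_int, sub_self, smul_zero]
  have hsol := List.findIdx_getElem (w := hlt)
  rw [decide_eq_true_iff] at hsol
  have h0 := proj_nthPrimePow_eq_zero_of_zsmul (eqCoeff_ne_zero hts)
    (hm ▸ natAbs_eqCoeff_le t s)
    ((key _).1 hsol)
  rw [map_sub, proj_int, sub_eq_zero, Int.cast_natCast] at h0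
  exact h0.trans (congrArg _ (List.getElem_range hlt))

theorem hasUniformlyComputableUniqueWitnesses :
    zHatTreeStructure.HasUniformlyComputableUniqueWitnesses := by
  classical
  let L : ℕ → ℕ := fun c => Nat.pair c.unpair.2.unpair.1 (c.unpair.2.unpair.2 + c.unpair.1)
  let g : ℕ → List ℕ → Option ℕ := fun c τ =>
    if ∀ k < c.unpair.1.unpair.1, Nat.pair k (L c) < τ.length then
      -- The search runs modulo a higher power and its result is meaningful only modulo the lower
      -- one, so it is reduced to the digit stored in the path.
      some (solution c.unpair.1 c.unpair.2.unpair.1 c.unpair.2.unpair.2 τ %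
        nthPrimePow c.unpair.2.unpair.1 c.unpair.2.unpair.2)
    else none
  have hg : Primrec₂ g := by
    have hm : Primrec fun p : ℕ × List ℕ => p.1.unpair.1 :=
      Primrec.fst.comp (Primrec.unpair.comp .fst)
    have hk : Primrec fun p : ℕ × List ℕ => p.1.unpair.2.unpair :=
      Primrec.unpair.comp (Primrec.snd.comp (Primrec.unpair.comp .fst))
    have hi := Primrec.fst.comp hk
    have hl := Primrec.snd.comp hk
    have hL : Primrec fun p : ℕ × List ℕ => L p.1 :=
      Primrec.nat_pair.comp hi (Primrec.nat_add.comp hl hm)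
    exact Primrec.ite (PrimrecPred.forall_lt' (Primrec.fst.comp (Primrec.unpair.comp hm))
      (Primrec.nat_lt.comp (Primrec.nat_pair.comp .snd (hL.comp .fst))
        (Primrec.list_length.comp (Primrec.snd.comp .fst))))
      (Primrec.option_some.comp (Primrec.nat_mod.comp (primrec_solution hm hi hl .snd)
        (Primrec.nthPrimePow.comp hi hl))) (.const none)
  obtain ⟨Ψ, hΨ, H⟩ := IsTuringFunctional.exists_of_prefix hg.to_comp
  refine ⟨Ψ, hΨ, fun n t s hts X hX => ?_⟩
  rw [realize_iff, realize_existsEq_iff] at hX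
  obtain ⟨G, hG⟩ := hX
  have hn : (godel (existsEq t s)).unpair.1 = n := by rw [godel, Nat.unpair_pair]
  have h1 : eqCoeff t s • equivResidueSystems.symm (equivResidueSystems G) =
      eqLeft t s fun i : Fin n => systems X i := by
    rw [equivResidueSystems.symm_apply_apply]
    exact hG
  have h2 : ∀ G' : zHatTreeStructure.Dom, zHatTreeStructure.SatisfiesEq t s X G' →
      G' = equivResidueSystems G := fun G' hG' => by
    have h := zsmul_injective (eqCoeff_ne_zero hts)
      (((satisfiesEq_iff t s X G').1 hG').trans hG.symm)
    rw [← h, equivResidueSystems.apply_symm_apply]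
  refine ⟨equivResidueSystems G, (satisfiesEq_iff t s X _).2 h1, h2, ?_⟩
  generalize hm : godel (existsEq t s) = m at hn
  -- A prefix of this length contains the needed entry of each of the `n` paths, since their column
  -- indices are below `n`.
  refine fun k => H _ _ _ ⟨Nat.pair n (L (Nat.pair m k)), ?_⟩ fun r w hw => ?_
  · have : ∀ j < (Nat.pair m k).unpair.1.unpair.1, Nat.pair j (L (Nat.pair m k)) <
        ((List.range (Nat.pair n (L (Nat.pair m k)))).map
          (oracleJoin fun i => (X i).1)).length := fun j hj => by
      rw [Nat.unpair_pair, hn] at hj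
      rw [List.length_map, List.length_range]
      exact Nat.pair_lt_pair_left _ hj
    simp only [g, if_pos this, Option.isSome_some]
  · simp only [g, Nat.unpair_pair, List.length_map, List.length_range, hn] at hw
    split_ifs at hw with hlt
    rw [← Option.some.inj hw]
    have hspec := solution_spec hts X hG (i := k.unpair.1) (l := k.unpair.2) (r := r) hm
      fun j hj => by simpa [L] using hlt j hj
    have hval := equivResidueSystems_apply G k.unpair.1 k.unpair.2
    rw [hspec, ZMod.val_natCast, Nat.pair_unpair] at hval
    exact hval.symm

end zHatTreeStructure

theorem mainTheorem2 :
    zHatTreeStructure.IsComputablePresentation ∧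
    Nonempty (zHatTreeStructure.Dom ≃[addGroupLang] ZHat) ∧
    zHatTreeStructure.IsTreeDecidable ∧
    zHatTreeStructure.UniformlyEffectivelyClopen properExistentialAtomic ∧
    zHatTreeStructure.HasUniformlyComputableUniqueWitnesses :=
  ⟨zHatTreeStructure.isComputablePresentation,
    ⟨ZHat.equivResidueSystems.comp zHatTreeStructure.equivResidueSystems.symm⟩,
    zHatTreeStructure.isTreeDecidable, zHatTreeStructure.uniformlyEffectivelyClopen,
    zHatTreeStructure.hasUniformlyComputableUniqueWitnesses⟩
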